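/- **Proposition 5.2 (Control of jumps).** Let $\mathbb K=\mathbb R$ or $\mathbb K=\mathbb C$. For $n\ge 1$ let $m=m(n)\ge 1$ be integers with $n/m(n)\to y>0$, and let $V_n=(v^{(n)}_{ij})_{i\le n,\,j\le m}$ be random matrices with i.i.d. entries in $\mathbb K$ (whose law may depend on $n$) such that (i) the law of $v^{(n)}_{11}$ is absolutely continuous with respect to Lebesgue measure on $\mathbb K$; (ii) $\sup_n\mathbb E|v^{(n)}_{11}|^k<\infty$ for every integer $k\ge 0$. An *eigenmatrix* of a Hermitian $n\times n$ matrix $X$ over $\mathbb K$ is a unitary (orthogonal if $\mathbb K=\mathbb R$) matrix $U$ over $\mathbb K$ with $X=UDU^*$, $D$ real diagonal with non-decreasing diagonal. Let $U_n=(u_{ij})$ be an eigenmatrix, chosen in any measurable way, of $X_n=\frac1m V_nV_n^*$. Let $M_n$ be an $n\times m$ matrix of independent standard Gaussian variables on $\mathbb K$ (law $N(0,1)$ if $\mathbb K=\mathbb R$; if $\mathbb K=\mathbb C$, independent real and imaginary parts of law $N(0,1/2)$), and let $U_n'=(u_{ij}')$ be a measurable choice of an eigenmatrix of $L_n=\frac1m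 M_nM_n^*$. (If $m\le n-2$, the kernel of $L_n$ has dimension at least $2$, and the first $n-m$ columns of $U'_n$, which form an orthonormal basis of it almost surely, are chosen uniformly: the joint law of $(M_n,U_n')$ equals that of $(M_n,U_n'W)$ for every fixed unitary (orthogonal if $\mathbb K=\mathbb R$) $W$ over $\mathbb K$ that acts only on the first $n-m$ columns.) For $l\ge 4$ consider the following assumption. (iii)$_l$ $V_n$ matches $M_n$ up to order $l$ for every $n$, i.e. $\mathbb E[\mathrm{Re}(v_{ij})^a\,\mathrm{Im}(v_{ij})^b]=\mathbb E[\mathrm{Re}(M_{ij})^a\,\mathrm{Im}(M_{ij})^b]$ for all $i\le n$, $j\le m$ and integers $a,b\ge 0$ with $a+b\le l$; and the following hypothesis (Hypothesis 5.1) holds at order $l$: if $V_n$ matches $M_n$ up to order $l$ for every $n$, then for every $k\ge 1$ and every polynomial $G$ in $k$ variables over $\mathbb K$ there is a constant $C$ such that, for all $n\ge 1$ and all $(i_1,p_1,q_1),\dots,(i_k,p_k,q_k)\in\{1,\dots,n\}^3$, $$\bigl|\mathbb E\,G(n u_{p_1i_1}\overline{u_{q_1i_1}},\dots,n u_{p_ki_k}\overline{u_{q_ki_k}})-\mathbb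 E\,G(n u'_{p_1i_1}\overline{u'_{q_1i_1}},\dots,n u'_{p_ki_k}\overline{u'_{q_ki_k}})\bigr|\le C\,n^{2-l/2}.$$ Then: 1. If (iii)$_4$ holds, there is $C<\infty$ such that $\bigl\|\,n|u_{ij}|^2-1\bigr\|_{L^4}\le C$ for all $n\ge 1$ and all $1\le i,j\le n$. 2. If (iii)$_8$ holds, there is $C<\infty$ such that, for all $n\ge 1$ and all $0\le s<s'\le 1$, $0\le t<t'\le 1$ with $s'-s\ge 1/n$ and $t'-t\ge 1/n$, $$\Bigl\|\frac1{\sqrt{(s'-s)(t'-t)}}\sum_{\substack{ns<i\le ns'\\ nt<j\le nt'}}\Bigl(|u_{ij}|^2-\frac1n\Bigr)\Bigr\|_{L^2}\le C .$$ -/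

import Mathlib

open MeasureTheory ProbabilityTheory Filter Topology
open scoped NNReal ENNReal Matrix

/-- The sample covariance matrix `(1/m) V V*` of an `n × m` data matrix `V`. -/
noncomputable def sampleCov {𝕜 : Type*} [RCLike 𝕜] {n m : ℕ}
    (V : Matrix (Fin n) (Fin m) 𝕜) : Matrix (Fin n) (Fin n) 𝕜 :=
  ((m : 𝕜)⁻¹) • (V * Vᴴ)

/-- `U` is an eigenmatrix of `X`: `U` is unitary (orthogonal if `𝕜 = ℝ`) and `X = U D U*`, where
`D` is diagonal with real entries arranged in non-decreasing order. -/
def IsEigenmatrix {𝕜 : Type*} [RCLike 𝕜] {n : ℕ} (X U : Matrix (Fin n) (Fin n) 𝕜) : Prop :=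
  U ∈ Matrix.unitaryGroup (Fin n) 𝕜 ∧
    ∃ d : Fin n → ℝ, Monotone d ∧ X = U * Matrix.diagonal (fun j => (d j : 𝕜)) * Uᴴ

/-- `U` is a measurable choice of an eigenmatrix of the random matrix `X`. -/
def IsMeasurableEigenmatrix {𝕜 : Type*} [RCLike 𝕜] {Ω : Type*} [MeasurableSpace Ω]
    (μ : Measure Ω) {n : ℕ} (X U : Ω → Matrix (Fin n) (Fin n) 𝕜) : Prop :=
  (∀ i j, Measurable fun ω => U ω i j) ∧ ∀ᵐ ω ∂μ, IsEigenmatrix (X ω) (U ω)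

/-- The standard Gaussian law on `𝕜`: with `β = dim_ℝ 𝕜`, the law of `x + i y` where `x, y` are
independent and `N(0, 1/β)`. For `𝕜 = ℂ` this is the circular Gaussian law with `E|z|² = 1`; for
`𝕜 = ℝ`, where `RCLike.I = 0`, it is `N(0, 1)`. -/
noncomputable def stdGaussianLaw (𝕜 : Type*) [RCLike 𝕜] : Measure 𝕜 :=
  ((gaussianReal 0 ((Module.finrank ℝ 𝕜 : ℝ≥0)⁻¹)).prod
    (gaussianReal 0 ((Module.finrank ℝ 𝕜 : ℝ≥0)⁻¹))).map
      fun p : ℝ × ℝ => (p.1 : 𝕜) + (p.2 : 𝕜) * RCLike.I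

/-- `M` is a random matrix whose entries are independent standard Gaussian variables. -/
def IsGaussianMatrix {𝕜 : Type*} [RCLike 𝕜] {Ω : Type*} [MeasurableSpace Ω]
    (μ : Measure Ω) {n m : ℕ} (M : Ω → Matrix (Fin n) (Fin m) 𝕜) : Prop :=
  (∀ i j, Measurable fun ω => M ω i j) ∧
  (∀ i j, μ.map (fun ω => M ω i j) = stdGaussianLaw 𝕜) ∧
  iIndepFun (fun (p : Fin n × Fin m) ω => M ω p.1 p.2) μ

/-- Two random matrices match up to order `k`. -/
def MatchUpTo {𝕜 : Type*} [RCLike 𝕜] {Ω Ω' : Type*} [MeasurableSpace Ω] [MeasurableSpace Ω']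
    (μ : Measure Ω) (μ' : Measure Ω') (k : ℕ) {n m : ℕ}
    (V : Ω → Matrix (Fin n) (Fin m) 𝕜) (M : Ω' → Matrix (Fin n) (Fin m) 𝕜) : Prop :=
  ∀ (i : Fin n) (j : Fin m) (a b : ℕ), a + b ≤ k →
    ∫ ω, RCLike.re (V ω i j) ^ a * RCLike.im (V ω i j) ^ b ∂μ
      = ∫ ω, RCLike.re (M ω i j) ^ a * RCLike.im (M ω i j) ^ b ∂μ'

/-- Convention on the eigenmatrix `U` of `(1/m) M M*` when `m ≤ n - 2`. Then the kernel of `M*`,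
which is spanned by the first `n - m` columns of `U`, has dimension at least two, and
its orthonormal basis is not determined up to phases; it is chosen uniformly at random: given `M`,
its law is unchanged when it is rotated by a fixed unitary matrix `W` that mixes
only the first `n - m` columns. Nothing is required when `n ≤ m + 1`. -/
def KernelBasisUniform {𝕜 : Type*} [RCLike 𝕜] {Ω : Type*} [MeasurableSpace Ω]
    (μ : Measure Ω) {n m : ℕ} (M : Ω → Matrix (Fin n) (Fin m) 𝕜)
    (U : Ω → Matrix (Fin n) (Fin n) 𝕜) : Prop :=
  m + 2 ≤ n → ∀ W ∈ Matrix.unitaryGroup (Fin n) 𝕜,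
    (∀ i j : Fin n, n - m ≤ (j : ℕ) → W i j = (1 : Matrix (Fin n) (Fin n) 𝕜) i j) →
    μ.map (fun ω => ((fun i j => M ω i j, fun i j => (U ω * W) i j) :
        (Fin n → Fin m → 𝕜) × (Fin n → Fin n → 𝕜)))
      = μ.map (fun ω => (fun i j => M ω i j, fun i j => U ω i j))

/-- The matching hypothesis for eigenvectors, at order `l`: if `V n` matches the Gaussian matrix
`M n` up to order `l` for every `n`, then for every `k ≥ 1` and every polynomial `G` in `k`
variables there is a constant `C`, independent of `n` and of the indices, such that
`|E G(n u_{p₁i₁} ū_{q₁i₁}, …) - E G(n u'_{p₁i₁} ū'_{q₁i₁}, …)| ≤ C n^(2 - l/2)`. -/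
def EigenvectorMatching {𝕜 : Type*} [RCLike 𝕜] {Ω Ω' : Type*} [MeasurableSpace Ω]
    [MeasurableSpace Ω'] (μ : Measure Ω) (μ' : Measure Ω') (l : ℕ) (m : ℕ → ℕ)
    (V : (n : ℕ) → Ω → Matrix (Fin n) (Fin (m n)) 𝕜)
    (U : (n : ℕ) → Ω → Matrix (Fin n) (Fin n) 𝕜)
    (M : (n : ℕ) → Ω' → Matrix (Fin n) (Fin (m n)) 𝕜)
    (U' : (n : ℕ) → Ω' → Matrix (Fin n) (Fin n) 𝕜) : Prop :=
  (∀ n, MatchUpTo μ μ' l (V n) (M n)) →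
  ∀ (k : ℕ), 0 < k → ∀ G : MvPolynomial (Fin k) 𝕜, ∃ C : ℝ, ∀ (n : ℕ) (i p q : Fin k → Fin n),
    ‖(∫ ω, MvPolynomial.eval
          (fun r => (n : 𝕜) * U n ω (p r) (i r) * star (U n ω (q r) (i r))) G ∂μ)
      - ∫ ω, MvPolynomial.eval
          (fun r => (n : 𝕜) * U' n ω (p r) (i r) * star (U' n ω (q r) (i r))) G ∂μ'‖
      ≤ C * (n : ℝ) ^ (2 - (l : ℝ) / 2)

/-- The indices `i` with `n s < i ≤ n s'`. The element `i` of `Fin n` stands for the index `i + 1`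
of `{1, …, n}`. -/
noncomputable def blockIndices (n : ℕ) (s s' : ℝ) : Finset (Fin n) :=
  {i | (n : ℝ) * s < ((i : ℕ) : ℝ) + 1 ∧ ((i : ℕ) : ℝ) + 1 ≤ (n : ℝ) * s'}

/-- The normalised block sum
`((s' - s)(t' - t))^(-1/2) ∑_{ns < i ≤ ns', nt < j ≤ nt'} (|u_{ij}|² - 1/n)`. -/
noncomputable def blockSum {𝕜 : Type*} [RCLike 𝕜] {n : ℕ} (U : Matrix (Fin n) (Fin n) 𝕜)
    (s s' t t' : ℝ) : ℝ :=
  (1 / √((s' - s) * (t' - t))) *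
    ∑ i ∈ blockIndices n s s', ∑ j ∈ blockIndices n t t', (‖U i j‖ ^ 2 - 1 / (n : ℝ))

/-! The bounds are proved for the Laguerre eigenmatrix `U'` and transferred by the matching
hypothesis. At order 4, the polynomial `(X 0 - 1) ^ 4` costs an error `O(1)`. At order 8, `(X 0 - 1)
* (X 1 - 1)` costs `O(n⁻²)` per pair of entries. A block of area `δ` has at most `4 n² δ` entries,
so its squared sum, which carries a factor `n⁻²`, changes by `O(δ²)`, and `δ² ≤ δ` fits the
normalisation by `δ`. What remains is `E |u'_{ij}|^8 = O(n⁻⁴)` and a second moment `O(|A| |B| / n²)`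
for the centred sum over `A × B`.

`U'` need not be Haar distributed, because its phases are an arbitrary measurable choice. Two weaker
invariances replace this. On the left: if `B` avoids the undetermined kernel columns, or contains
them all, then `projOn B U'` is almost surely determined by `M`; since `O * M` has the law of `M`,
the law of this projection is invariant under conjugation (`conjInvariantOn_projOn`). This needs
nonzero eigenvalues that are distinct and as many as the rank allows, which a nonvanishing
polynomial certifies (`IsGaussianMatrix.ae_krylovMinor_ne_zero`). On the right: compressions of
diagonal matrices to the kernel columns are conjugation invariant by the convention on the kernel
basis (`conjInvariantOn_compression`).

Moments of an invariant Hermitian matrix are bounded without Haar integration, by permutations and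
one plane reflection (`ConjInvariantOn.integral_pow_four_le`, `ConjInvariantOn.integral_sq_sum_le`).
For a column of a simple eigenvalue, `|u'_{ij}|²` is a diagonal entry of a spectral projection, and
left invariance suffices. For a kernel column the bounds are used twice: right invariance compares
`|u'_{ij}|²` with its sum over the kernel columns, and left invariance controls that sum, a diagonal
entry of the kernel projection. -/

/-! ### Random Hermitian matrices invariant under unitary conjugation -/

section ConjInvariant

set_option linter.unusedSectionVars false

variable {𝕜 : Type*} [RCLike 𝕜] {ι : Type*} [Fintype ι] [DecidableEq ι]
  {X : Type*} [MeasurableSpace X]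

/-- The law of the random matrix `K` is invariant under conjugation by unitary matrices that mix
only the columns with index in `S`. -/
def ConjInvariantOn (S : Finset ι) (ν : Measure X) (K : X → Matrix ι ι 𝕜) : Prop :=
  ∀ W ∈ Matrix.unitaryGroup ι 𝕜, (∀ i j, j ∉ S → W i j = (1 : Matrix ι ι 𝕜) i j) →
    ∀ f : Matrix ι ι 𝕜 → ℝ, Continuous f → ∫ x, f (Wᴴ * K x * W) ∂ν = ∫ x, f (K x) ∂ν

theorem Continuous.integrable_of_compactSpace [TopologicalSpace X] [CompactSpace X] [OpensMeasurableSpace X]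
    {ν : Measure X} [IsFiniteMeasure ν] {E : Type*} [NormedAddCommGroup E] {f : X → E}
    (hf : Continuous f) : Integrable f ν :=
  hf.integrable_of_hasCompactSupport (HasCompactSupport.of_compactSpace f)

/-- The permutation matrix of `σ`, whose column `j` is the basis vector with index `σ j`. -/
def permCols (𝕜 : Type*) [RCLike 𝕜] (σ : Equiv.Perm ι) : Matrix ι ι 𝕜 :=
  Matrix.of fun i j => if i = σ j then 1 else 0

theorem conjTranspose_permCols_mul_mul (σ : Equiv.Perm ι) (A : Matrix ι ι 𝕜) :
    (permCols 𝕜 σ)ᴴ * A * permCols 𝕜 σ = Matrix.of fun i j => A (σ i) (σ j) := by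
  ext i j
  simp [permCols, Matrix.mul_apply, apply_ite]

theorem permCols_mem_unitaryGroup (σ : Equiv.Perm ι) :
    permCols 𝕜 σ ∈ Matrix.unitaryGroup ι 𝕜 := by
  rw [Matrix.mem_unitaryGroup_iff', Matrix.star_eq_conjTranspose]
  have := conjTranspose_permCols_mul_mul (𝕜 := 𝕜) σ 1
  rw [Matrix.mul_one] at this
  rw [this]
  ext i j
  simp [Matrix.one_apply]

/-- The reflection that maps the basis vectors `e a`, `e b` to `(e a ± e b) / √2`. -/
noncomputable def planeReflection (𝕜 : Type*) [RCLike 𝕜] (a b : ι) : Matrix ι ι 𝕜 :=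
  Matrix.of fun i j =>
    if j = a then (if i = a then ((√2)⁻¹ : ℝ) else if i = b then ((√2)⁻¹ : ℝ) else 0 : 𝕜)
    else if j = b then (if i = a then ((√2)⁻¹ : ℝ) else if i = b then (-(√2)⁻¹ : ℝ) else 0 : 𝕜)
    else if i = j then 1 else 0

theorem inv_sqrt_two_mul_self (𝕜 : Type*) [RCLike 𝕜] :
    (((√2)⁻¹ : ℝ) : 𝕜) * (((√2)⁻¹ : ℝ) : 𝕜) = 1 / 2 := by
  rw [← RCLike.ofReal_mul, ← mul_inv, Real.mul_self_sqrt (by norm_num)]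
  push_cast
  norm_num

theorem sum_mul_planeReflection {a b : ι} (hab : a ≠ b) (f : ι → 𝕜) :
    (∑ i, f i * planeReflection 𝕜 a b i a = ((√2)⁻¹ : ℝ) * (f a + f b)) ∧
    (∑ i, f i * planeReflection 𝕜 a b i b = ((√2)⁻¹ : ℝ) * (f a - f b)) ∧
    ∀ j, j ≠ a → j ≠ b → ∑ i, f i * planeReflection 𝕜 a b i j = f j := by
  refine ⟨?_, ?_, ?_⟩
  · have h : ∀ i, f i * planeReflection 𝕜 a b i a
        = (if i = a then f a * ((√2)⁻¹ : ℝ) else 0) + (if i = b then f b * ((√2)⁻¹ : ℝ) else 0) := by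
      intro i
      by_cases h1 : i = a
      · subst h1; simp [planeReflection, hab]
      · by_cases h2 : i = b
        · subst h2; simp [planeReflection, hab.symm]
        · simp [planeReflection, h1, h2]
    simp_rw [h, Finset.sum_add_distrib, Finset.sum_ite_eq' Finset.univ, Finset.mem_univ, if_true]
    ring
  · have h : ∀ i, f i * planeReflection 𝕜 a b i b
        = (if i = a then f a * ((√2)⁻¹ : ℝ) else 0) - (if i = b then f b * ((√2)⁻¹ : ℝ) else 0) := by
      intro i
      by_cases h1 : i = a
      · subst h1; simp [planeReflection, hab, hab.symm]
      · by_cases h2 : i = b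
        · subst h2; simp [planeReflection, hab.symm]
        · simp [planeReflection, h1, h2, hab.symm]
    simp_rw [h, Finset.sum_sub_distrib, Finset.sum_ite_eq' Finset.univ, Finset.mem_univ, if_true]
    ring
  · intro j ha hb
    simp [planeReflection, ha, hb]

theorem star_planeReflection (a b i j : ι) :
    star (planeReflection 𝕜 a b i j) = planeReflection 𝕜 a b i j := by
  simp only [planeReflection, Matrix.of_apply]
  split_ifs <;> simp

/-- This is the only symmetry used besides permutations: it exchanges the difference of two diagonal
entries for off-diagonal ones, and so ties the two kinds of moments together. -/
theorem conj_planeReflection_apply {a b : ι} (hab : a ≠ b) (A : Matrix ι ι 𝕜) :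
    ((planeReflection 𝕜 a b)ᴴ * A * planeReflection 𝕜 a b) a a
        = 1 / 2 * (A a a + A b b + (A a b + A b a)) ∧
    ((planeReflection 𝕜 a b)ᴴ * A * planeReflection 𝕜 a b) b b
        = 1 / 2 * (A a a + A b b - (A a b + A b a)) := by
  have key : ∀ i j, ((planeReflection 𝕜 a b)ᴴ * A * planeReflection 𝕜 a b) i j
      = ∑ l, (∑ k, A k l * planeReflection 𝕜 a b k i) * planeReflection 𝕜 a b l j := by
    intro i j
    simp only [Matrix.mul_apply, Matrix.conjTranspose_apply, star_planeReflection]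
    exact Finset.sum_congr rfl fun l _ => by
      congr 1; exact Finset.sum_congr rfl fun k _ => mul_comm _ _
  have h2 := inv_sqrt_two_mul_self 𝕜
  refine ⟨?_, ?_⟩
  · rw [key, (sum_mul_planeReflection hab _).1]
    simp only [(sum_mul_planeReflection hab _).1]
    linear_combination (A a a + A b b + (A a b + A b a)) * h2
  · rw [key, (sum_mul_planeReflection hab _).2.1]
    simp only [(sum_mul_planeReflection hab _).2.1]
    linear_combination (A a a + A b b - (A a b + A b a)) * h2

theorem planeReflection_mem_unitaryGroup {a b : ι} (hab : a ≠ b) :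
    planeReflection 𝕜 a b ∈ Matrix.unitaryGroup ι 𝕜 := by
  rw [Matrix.mem_unitaryGroup_iff', Matrix.star_eq_conjTranspose]
  have h2 := inv_sqrt_two_mul_self 𝕜
  have A := sum_mul_planeReflection (𝕜 := 𝕜) hab
  have eaa : planeReflection 𝕜 a b a a = ((√2)⁻¹ : ℝ) := by simp [planeReflection]
  have eba : planeReflection 𝕜 a b b a = ((√2)⁻¹ : ℝ) := by simp [planeReflection, hab.symm]
  have eab : planeReflection 𝕜 a b a b = ((√2)⁻¹ : ℝ) := by simp [planeReflection, hab.symm]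
  have ebb : planeReflection 𝕜 a b b b = (-(√2)⁻¹ : ℝ) := by simp [planeReflection, hab.symm]
  have e0 : ∀ i, i ≠ a → i ≠ b →
      planeReflection 𝕜 a b i a = 0 ∧ planeReflection 𝕜 a b i b = 0 := by
    intro i h1 h2
    simp [planeReflection, h1, h2, hab.symm]
  have e1 : ∀ j, j ≠ a → j ≠ b → planeReflection 𝕜 a b a j = 0 ∧ planeReflection 𝕜 a b b j = 0 := by
    intro j h1 h2
    simp [planeReflection, h1, h2, h1.symm, h2.symm]
  ext i j
  simp only [Matrix.mul_apply, Matrix.conjTranspose_apply, star_planeReflection]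
  by_cases ja : j = a
  · subst ja
    rw [(A _).1]
    by_cases ia : i = j
    · subst ia; rw [eaa, eba]; simp only [Matrix.one_apply_eq]; linear_combination 2 * h2
    · by_cases ib : i = b
      · subst ib; rw [eab, ebb, Matrix.one_apply_ne ia]; push_cast; ring
      · rw [(e1 i ia ib).1, (e1 i ia ib).2, Matrix.one_apply_ne ia]; simp
  · by_cases jb : j = b
    · subst jb
      rw [(A _).2.1]
      by_cases ia : i = a
      · subst ia; rw [eaa, eba, Matrix.one_apply_ne hab]; simp
      · by_cases ib : i = j
        · subst ib; rw [eab, ebb]; simp only [Matrix.one_apply_eq]; push_cast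
          push_cast at h2
          linear_combination 2 * h2
        · rw [(e1 i ia ib).1, (e1 i ia ib).2, Matrix.one_apply_ne ib]; simp
    · rw [(A _).2.2 j ja jb]
      by_cases ia : i = a
      · subst ia; rw [(e0 j ja jb).1, Matrix.one_apply_ne (Ne.symm ja)]
      · by_cases ib : i = b
        · subst ib; rw [(e0 j ja jb).2, Matrix.one_apply_ne (Ne.symm jb)]
        · simp [planeReflection, ia, ib, Matrix.one_apply, @eq_comm _ j i]

theorem ConjInvariantOn.integral_perm {S : Finset ι} {ν : Measure X} {K : X → Matrix ι ι 𝕜}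
    (h : ConjInvariantOn S ν K) (σ : Equiv.Perm ι) (hσ : ∀ j, j ∉ S → σ j = j)
    {f : Matrix ι ι 𝕜 → ℝ} (hf : Continuous f) :
    ∫ x, f (Matrix.of fun i j => K x (σ i) (σ j)) ∂ν = ∫ x, f (K x) ∂ν := by
  rw [← h (permCols 𝕜 σ) (permCols_mem_unitaryGroup σ) ?_ f hf]
  · simp_rw [conjTranspose_permCols_mul_mul]
  · intro i j hj
    simp [permCols, hσ j hj, Matrix.one_apply]

theorem ConjInvariantOn.integral_reflection {S : Finset ι} {ν : Measure X} {K : X → Matrix ι ι 𝕜}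
    (h : ConjInvariantOn S ν K) {a b : ι} (ha : a ∈ S) (hb : b ∈ S) (hab : a ≠ b)
    {f : Matrix ι ι 𝕜 → ℝ} (hf : Continuous f) :
    ∫ x, f ((planeReflection 𝕜 a b)ᴴ * K x * planeReflection 𝕜 a b) ∂ν = ∫ x, f (K x) ∂ν := by
  refine h _ (planeReflection_mem_unitaryGroup hab) ?_ f hf
  intro i j hj
  have h1 : j ≠ a := fun e => hj (e ▸ ha)
  have h2 : j ≠ b := fun e => hj (e ▸ hb)
  simp [planeReflection, h1, h2, Matrix.one_apply]

/-- Permutations act doubly transitively on `S`. -/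
theorem exists_perm_map_pair {S : Finset ι} {a b a' b' : ι} (ha : a ∈ S) (hb : b ∈ S)
    (ha' : a' ∈ S) (hb' : b' ∈ S) (hab : a ≠ b) (hab' : a' ≠ b') :
    ∃ σ : Equiv.Perm ι, (∀ j, j ∉ S → σ j = j) ∧ σ a = a' ∧ σ b = b' := by
  have hτS : ∀ c ∈ S, Equiv.swap a a' c ∈ S := by
    intro c hc
    rw [Equiv.swap_apply_def]; split_ifs <;> assumption
  have hτb : Equiv.swap a a' b ≠ a' := by
    intro h
    have := congrArg (Equiv.swap a a') h
    rw [Equiv.swap_apply_self, Equiv.swap_apply_right] at this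
    exact hab this.symm
  refine ⟨Equiv.swap (Equiv.swap a a' b) b' * Equiv.swap a a', ?_, ?_, ?_⟩
  · intro j hj
    rw [Equiv.Perm.mul_apply, Equiv.swap_apply_of_ne_of_ne (a := a) (b := a') (x := j),
      Equiv.swap_apply_of_ne_of_ne]
    · rintro rfl; exact hj (hτS b hb)
    · rintro rfl; exact hj hb'
    · rintro rfl; exact hj ha
    · rintro rfl; exact hj ha'
  · rw [Equiv.Perm.mul_apply, Equiv.swap_apply_left,
      Equiv.swap_apply_of_ne_of_ne hτb.symm hab']
  · rw [Equiv.Perm.mul_apply, Equiv.swap_apply_left]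

/-- A quadratic form with constant diagonal and constant off-diagonal coefficients, at a vector
with sum zero. -/
theorem sum_mul_mul_of_two_values {S : Finset ι} {d : ι → ℝ} (hd : ∑ a ∈ S, d a = 0)
    {f : ι → ι → ℝ} {α γ : ℝ} (hα : ∀ a ∈ S, f a a = α)
    (hγ : ∀ a ∈ S, ∀ b ∈ S, a ≠ b → f a b = γ) :
    ∑ a ∈ S, ∑ b ∈ S, d a * d b * f a b = (α - γ) * ∑ a ∈ S, d a ^ 2 := by
  have h1 : ∀ a ∈ S, ∑ b ∈ S, d a * d b * f a b = (α - γ) * d a ^ 2 := by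
    intro a ha
    have : ∀ b ∈ S, d a * d b * f a b
        = d a * γ * d b + if b = a then (α - γ) * d a ^ 2 else 0 := by
      intro b hb
      split_ifs with h
      · subst h; rw [hα b hb]; ring
      · rw [hγ a ha b hb (Ne.symm h)]; ring
    rw [Finset.sum_congr rfl this, Finset.sum_add_distrib, ← Finset.mul_sum, hd,
      Finset.sum_ite_eq' S, if_pos ha]
    ring
  rw [Finset.sum_congr rfl h1, Finset.mul_sum]

end ConjInvariant

/-! ### Moment bounds from permutations and one reflection -/

section ConjInvariantMoments

set_option linter.unusedSectionVars false

variable {𝕜 : Type*} [RCLike 𝕜] {ι : Type*} [Fintype ι] [DecidableEq ι]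
  {X : Type*} [TopologicalSpace X] [CompactSpace X] [MeasurableSpace X] [OpensMeasurableSpace X]
  {ν : Measure X} [IsFiniteMeasure ν] {S : Finset ι} {K : X → Matrix ι ι 𝕜}

/-- Permutation matrices are unitary, and the permutations supported on `S` are doubly transitive
there. -/
theorem ConjInvariantOn.integral_apply_pair (h : ConjInvariantOn S ν K)
    {a b a' b' : ι} (ha : a ∈ S) (hb : b ∈ S) (ha' : a' ∈ S) (hb' : b' ∈ S)
    (hab : a ≠ b) (hab' : a' ≠ b') {g : 𝕜 → 𝕜 → 𝕜 → ℝ}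
    (hg : Continuous fun p : 𝕜 × 𝕜 × 𝕜 => g p.1 p.2.1 p.2.2) :
    ∫ x, g (K x a' a') (K x b' b') (K x a' b') ∂ν
      = ∫ x, g (K x a a) (K x b b) (K x a b) ∂ν := by
  obtain ⟨σ, hσ, rfl, rfl⟩ := exists_perm_map_pair ha hb ha' hb' hab hab'
  have hf : Continuous fun A : Matrix ι ι 𝕜 => g (A a a) (A b b) (A a b) :=
    hg.comp (f := fun A : Matrix ι ι 𝕜 => (A a a, A b b, A a b)) (by fun_prop)
  have := h.integral_perm σ hσ hf
  simpa using this

theorem ConjInvariantOn.integral_apply_diag (h : ConjInvariantOn S ν K)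
    {a a' : ι} (ha : a ∈ S) (ha' : a' ∈ S) {g : 𝕜 → ℝ} (hg : Continuous g) :
    ∫ x, g (K x a' a') ∂ν = ∫ x, g (K x a a) ∂ν := by
  by_cases haa : a = a'
  · rw [haa]
  have hf : Continuous fun A : Matrix ι ι 𝕜 => g (A a a) := by fun_prop
  have := h.integral_perm (Equiv.swap a a') (fun j hj => Equiv.swap_apply_of_ne_of_ne
    (fun e => hj (e ▸ ha)) (fun e => hj (e ▸ ha'))) hf
  simpa using this

/-- The left side is `(a + b)^4 / 8 + 3 (a + b)² r² + 2 r⁴`. What matters is the coefficient `1/8 <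
1` of the pure fourth powers, which lets them be absorbed; all other terms are mixed, and `a² b²` is
at most the mean of `a³ b` and `a b³`. -/
theorem half_sum_pow_four_le {a b r : ℝ} (ha : 0 ≤ a) (hb : 0 ≤ b) (hr : r ^ 2 ≤ a * b) :
    (1 / 2 * (a + b) + r) ^ 4 + (1 / 2 * (a + b) - r) ^ 4
      ≤ (a ^ 4 + b ^ 4) / 8 + 8 * (a ^ 3 * b + b ^ 3 * a) := by
  have hab : 0 ≤ a * b := mul_nonneg ha hb
  have h1 : r ^ 2 * (a + b) ^ 2 ≤ a * b * (a + b) ^ 2 := by gcongr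
  have h2 : r ^ 2 * r ^ 2 ≤ (a * b) * (a * b) := by gcongr
  have h3 : (0 : ℝ) ≤ (a * b) * (a - b) ^ 2 := by positivity
  nlinarith

theorem re_half_add (z w u v : 𝕜) :
    RCLike.re (1 / 2 * (z + w + (u + v)))
      = 1 / 2 * (RCLike.re z + RCLike.re w) + 1 / 2 * (RCLike.re u + RCLike.re v) := by
  rw [show (1 / 2 : 𝕜) = ((1 / 2 : ℝ) : 𝕜) by push_cast; rfl, RCLike.re_ofReal_mul]
  simp only [map_add]
  ring

theorem re_half_sub (z w u v : 𝕜) :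
    RCLike.re (1 / 2 * (z + w - (u + v)))
      = 1 / 2 * (RCLike.re z + RCLike.re w) - 1 / 2 * (RCLike.re u + RCLike.re v) := by
  rw [show (1 / 2 : 𝕜) = ((1 / 2 : ℝ) : 𝕜) by push_cast; rfl, RCLike.re_ofReal_mul]
  simp only [map_add, map_sub]
  ring

theorem re_sq_le_norm_sq (z : 𝕜) : RCLike.re z ^ 2 ≤ ‖z‖ ^ 2 := by
  rw [sq_le_sq, abs_norm]; exact RCLike.abs_re_le_norm _

theorem Matrix.IsHermitian.re_apply_comm {A : Matrix ι ι 𝕜} (hA : A.IsHermitian) (a b : ι) :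
    RCLike.re (A b a) = RCLike.re (A a b) := by
  rw [← hA.apply a b]
  simp

/-- Fourth moments of the diagonal entries of an invariant positive semidefinite matrix. -/
theorem ConjInvariantOn.integral_pow_four_le (h : ConjInvariantOn S ν K) (hK : Continuous K)
    (hherm : ∀ x, (K x).IsHermitian) (hpos : ∀ x, ∀ a ∈ S, 0 ≤ RCLike.re (K x a a))
    (hcs : ∀ x, ∀ a ∈ S, ∀ b ∈ S,
      RCLike.re (K x a b) ^ 2 ≤ RCLike.re (K x a a) * RCLike.re (K x b b))
    {a : ι} (ha : a ∈ S) :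
    ∫ x, RCLike.re (K x a a) ^ 4 ∂ν
      ≤ 20 ^ 4 / (S.card : ℝ) ^ 4 * ∫ x, (∑ b ∈ S, RCLike.re (K x b b)) ^ 4 ∂ν := by
  set D : ι → X → ℝ := fun b x => RCLike.re (K x b b) with hD
  have cD : ∀ b, Continuous (D b) := fun b => by simp only [hD]; fun_prop
  set w : X → ℝ := fun x => ∑ b ∈ S, D b x with hw
  have cw : Continuous w := by simp only [hw]; fun_prop
  have hw0 : ∀ x, 0 ≤ w x := fun x => Finset.sum_nonneg fun b hb => hpos x b hb
  have hDw : ∀ x, D a x ≤ w x := fun x =>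
    Finset.single_le_sum (f := fun b => D b x) (fun b hb => hpos x b hb) ha
  change ∫ x, D a x ^ 4 ∂ν ≤ 20 ^ 4 / (S.card : ℝ) ^ 4 * ∫ x, w x ^ 4 ∂ν
  set α := ∫ x, D a x ^ 4 ∂ν with hα
  have int : ∀ {f : X → ℝ}, Continuous f → Integrable f ν := fun hf => hf.integrable_of_compactSpace
  have hN : 1 ≤ S.card := Finset.card_pos.2 ⟨a, ha⟩
  -- The reflection preserves both fourth moments, so the pointwise inequality integrates to `2 α ≤
  -- α / 4 + 16 ∫ D a ^ 3 * D b`, and `64 / 7 ≤ 10`.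
  have hpair : ∀ b ∈ S, b ≠ a → α ≤ 10 * ∫ x, D a x ^ 3 * D b x ∂ν := by
    intro b hb hba
    have e1 : ∫ x, D b x ^ 4 ∂ν = α :=
      h.integral_apply_diag ha hb (g := fun z => RCLike.re z ^ 4) (by fun_prop)
    have e2 : ∫ x, D b x ^ 3 * D a x ∂ν = ∫ x, D a x ^ 3 * D b x ∂ν :=
      h.integral_apply_pair ha hb hb ha (Ne.symm hba) hba
        (g := fun z w _ => RCLike.re z ^ 3 * RCLike.re w) (by fun_prop)
    have r1 := h.integral_reflection ha hb (Ne.symm hba)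
      (f := fun A => RCLike.re (A a a) ^ 4) (by fun_prop)
    have r2 := h.integral_reflection ha hb (Ne.symm hba)
      (f := fun A => RCLike.re (A b b) ^ 4) (by fun_prop)
    simp only [(conj_planeReflection_apply (Ne.symm hba) _).1, re_half_add,
      (hherm _).re_apply_comm a b] at r1
    simp only [(conj_planeReflection_apply (Ne.symm hba) _).2, re_half_sub,
      (hherm _).re_apply_comm a b] at r2
    have hle : α + α ≤ (α + α) / 8 + 8 * (∫ x, D a x ^ 3 * D b x ∂ν + ∫ x, D b x ^ 3 * D a x ∂ν) := by
      calc α + α = ∫ x, RCLike.re (K x a a) ^ 4 ∂ν + ∫ x, RCLike.re (K x b b) ^ 4 ∂ν := by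
            change α + α = α + ∫ x, D b x ^ 4 ∂ν
            rw [e1]
        _ = ∫ x, ((1 / 2 * (D a x + D b x) + RCLike.re (K x a b)) ^ 4
              + (1 / 2 * (D a x + D b x) - RCLike.re (K x a b)) ^ 4) ∂ν := by
            rw [← r1, ← r2, ← integral_add (int (by fun_prop)) (int (by fun_prop))]
            refine integral_congr_ae (.of_forall fun x => ?_)
            simp only [hD]; ring
        _ ≤ ∫ x, ((D a x ^ 4 + D b x ^ 4) / 8
              + 8 * (D a x ^ 3 * D b x + D b x ^ 3 * D a x)) ∂ν :=
            integral_mono (int (by fun_prop)) (int (by fun_prop)) fun x =>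
              half_sum_pow_four_le (hpos x a ha) (hpos x b hb) (hcs x a ha b hb)
        _ = _ := by
            rw [integral_add (int (by fun_prop)) (int (by fun_prop)), integral_div,
              integral_add (int (by fun_prop)) (int (by fun_prop)), integral_const_mul,
              integral_add (int (by fun_prop)) (int (by fun_prop)), e1]
    have hα0 : 0 ≤ α := integral_nonneg fun x => by positivity
    linarith
  -- Summation of `hpair` over the `N - 1` indices `b ≠ a`; the inequality `N ≤ 2 (N - 1)` turns 10
  -- into 20. When `N = 1`, `D a ≤ w` is enough.
  have hsum : (S.card : ℝ) * α ≤ 20 * ∫ x, D a x ^ 3 * w x ∂ν := by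
    have hαw : α ≤ ∫ x, D a x ^ 3 * w x ∂ν := by
      refine integral_mono (int (by fun_prop)) (int (by fun_prop)) fun x => ?_
      have := hpos x a ha
      calc D a x ^ 4 = D a x ^ 3 * D a x := by ring
        _ ≤ D a x ^ 3 * w x := mul_le_mul_of_nonneg_left (hDw x) (pow_nonneg this 3)
    have hα0 : 0 ≤ α := integral_nonneg fun x => by positivity
    rcases Nat.lt_or_ge S.card 2 with h2 | h2
    · have : S.card = 1 := by omega
      rw [this]; push_cast; linarith
    · have h3 : ((S.card : ℝ) - 1) * α ≤ 10 * ∫ x, D a x ^ 3 * w x ∂ν := by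
        have : ∑ b ∈ S.erase a, α ≤ ∑ b ∈ S.erase a, 10 * ∫ x, D a x ^ 3 * D b x ∂ν :=
          Finset.sum_le_sum fun b hb => hpair b (Finset.mem_of_mem_erase hb) (Finset.ne_of_mem_erase hb)
        rw [Finset.sum_const, Finset.card_erase_of_mem ha, nsmul_eq_mul, Nat.cast_sub hN,
          Nat.cast_one, ← Finset.mul_sum, ← integral_finsetSum _ fun b _ => int (by fun_prop)] at this
        refine this.trans (mul_le_mul_of_nonneg_left ?_ (by norm_num))
        refine integral_mono (int (by fun_prop)) (int (by fun_prop)) fun x => ?_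
        change ∑ b ∈ S.erase a, D a x ^ 3 * D b x ≤ _
        rw [← Finset.mul_sum]
        refine mul_le_mul_of_nonneg_left ?_ (pow_nonneg (hpos x a ha) 3)
        exact Finset.sum_le_sum_of_subset_of_nonneg (Finset.erase_subset a S)
          fun b hb _ => hpos x b hb
      have h4 : (2 : ℝ) ≤ S.card := by exact_mod_cast h2
      nlinarith
  have hN' : (0 : ℝ) < S.card := by exact_mod_cast hN
  set N : ℝ := (S.card : ℝ) with hNdef
  -- Young's inequality with exponents `4/3` and `4`: the term `3/4 * α` is then moved to the left.
  have hyoung : ∀ x, D a x ^ 3 * (20 / N * w x) ≤ 3 / 4 * D a x ^ 4 + 1 / 4 * (20 / N * w x) ^ 4 := by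
    intro x
    generalize 20 / N * w x = v
    generalize D a x = u
    nlinarith [sq_nonneg (u ^ 2 - v * u), sq_nonneg (u ^ 2 - v ^ 2), sq_nonneg (u - v),
      sq_nonneg (u * (u - v)), sq_nonneg (v * (u - v)), mul_nonneg (sq_nonneg (u - v)) (sq_nonneg (u + v))]
  have hfin : α ≤ 3 / 4 * α + 1 / 4 * ((20 / N) ^ 4 * ∫ x, w x ^ 4 ∂ν) := by
    calc α ≤ 20 / N * ∫ x, D a x ^ 3 * w x ∂ν := by
          rw [div_mul_eq_mul_div, le_div_iff₀ hN']; linarith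
      _ = ∫ x, D a x ^ 3 * (20 / N * w x) ∂ν := by
          rw [← integral_const_mul]
          exact integral_congr_ae (.of_forall fun x => by ring)
      _ ≤ ∫ x, (3 / 4 * D a x ^ 4 + 1 / 4 * (20 / N * w x) ^ 4) ∂ν :=
          integral_mono (int (by fun_prop)) (int (by fun_prop)) hyoung
      _ = _ := by
          rw [integral_add (int (by fun_prop)) (int (by fun_prop)), integral_const_mul,
            integral_const_mul]
          simp_rw [mul_pow]
          rw [integral_const_mul]
  rw [← div_pow]
  linarith

/-- Second moment of centred linear statistics of the diagonal of an invariant matrix. -/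
theorem ConjInvariantOn.integral_sq_sum_le (h : ConjInvariantOn S ν K) (hK : Continuous K)
    (hherm : ∀ x, (K x).IsHermitian) {d : ι → ℝ} (hd : ∑ a ∈ S, d a = 0) :
    ∫ x, (∑ a ∈ S, d a * RCLike.re (K x a a)) ^ 2 ∂ν
      ≤ 4 / (S.card : ℝ) ^ 2 * (∫ x, ∑ a ∈ S, ∑ b ∈ S, ‖K x a b‖ ^ 2 ∂ν) * ∑ a ∈ S, d a ^ 2 := by
  have int : ∀ {f : X → ℝ}, Continuous f → Integrable f ν := fun hf => hf.integrable_of_compactSpace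
  have hF0 : 0 ≤ ∫ x, ∑ a ∈ S, ∑ b ∈ S, ‖K x a b‖ ^ 2 ∂ν :=
    integral_nonneg fun x => by positivity
  rcases Nat.lt_or_ge S.card 2 with h2 | h2
  · have hz : ∀ a ∈ S, d a = 0 := by
      intro a ha
      have : S = {a} := by
        apply Finset.eq_singleton_iff_unique_mem.2 ⟨ha, fun b hb => ?_⟩
        exact Finset.card_le_one.1 (by omega) b hb a ha
      rw [this, Finset.sum_singleton] at hd
      exact hd
    have : ∀ x, ∑ a ∈ S, d a * RCLike.re (K x a a) = 0 := fun x =>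
      Finset.sum_eq_zero fun a ha => by rw [hz a ha, zero_mul]
    simp only [this]
    simp only [ne_eq, OfNat.ofNat_ne_zero, not_false_eq_true, zero_pow, integral_zero]
    positivity
  obtain ⟨a₀, ha₀, b₀, hb₀, hab₀⟩ := Finset.one_lt_card.1 h2
  set D : ι → X → ℝ := fun b x => RCLike.re (K x b b) with hD
  have cD : ∀ b, Continuous (D b) := fun b => by simp only [hD]; fun_prop
  set θ := ∫ x, (D a₀ x - D b₀ x) ^ 2 ∂ν with hθ
  have hf : ∀ a ∈ S, ∀ b ∈ S, a ≠ b → ∫ x, (D a x - D b x) ^ 2 ∂ν = θ := fun a ha b hb hab =>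
    h.integral_apply_pair ha₀ hb₀ ha hb hab₀ hab
      (g := fun z w _ => (RCLike.re z - RCLike.re w) ^ 2) (by fun_prop)
  have h1 : ∫ x, (∑ a ∈ S, d a * D a x) ^ 2 ∂ν = 1 / 2 * θ * ∑ a ∈ S, d a ^ 2 := by
    -- As `d` sums to zero, only differences of diagonal entries matter, and their second moment `θ`
    -- is the same for every pair.
    have hpt : ∀ x, (∑ a ∈ S, d a * D a x) ^ 2
        = -1 / 2 * ∑ a ∈ S, ∑ b ∈ S, d a * d b * (D a x - D b x) ^ 2 := by
      intro x
      have : ∀ a ∈ S, ∑ b ∈ S, d a * d b * (D a x - D b x) ^ 2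
          = d a * ∑ b ∈ S, d b * D b x ^ 2 - 2 * (d a * D a x) * ∑ b ∈ S, d b * D b x := by
        intro a ha
        have h0 : d a * D a x ^ 2 * ∑ b ∈ S, d b = 0 := by rw [hd, mul_zero]
        rw [← add_zero (d a * ∑ b ∈ S, d b * D b x ^ 2 - _), ← h0, Finset.mul_sum, Finset.mul_sum,
          Finset.mul_sum, ← Finset.sum_sub_distrib, ← Finset.sum_add_distrib]
        exact Finset.sum_congr rfl fun b _ => by ring
      rw [Finset.sum_congr rfl this, Finset.sum_sub_distrib, ← Finset.sum_mul, hd,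
        ← Finset.sum_mul, ← Finset.mul_sum]
      ring
    simp_rw [hpt]
    rw [integral_const_mul, integral_finsetSum _ fun a _ => int (by fun_prop)]
    have : ∀ a ∈ S, ∫ x, ∑ b ∈ S, d a * d b * (D a x - D b x) ^ 2 ∂ν
        = ∑ b ∈ S, d a * d b * ∫ x, (D a x - D b x) ^ 2 ∂ν := by
      intro a _
      rw [integral_finsetSum _ fun a _ => int (by fun_prop)]
      exact Finset.sum_congr rfl fun b _ => integral_const_mul _ _
    rw [Finset.sum_congr rfl this,
      sum_mul_mul_of_two_values (f := fun a b => ∫ x, (D a x - D b x) ^ 2 ∂ν) hd (α := 0)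
        (fun a _ => by simp) hf]
    ring
  -- The reflection turns `D a - D b` into `2 Re K a b`, hence the factor 4.
  have hθle : ∀ a ∈ S, ∀ b ∈ S, a ≠ b → θ ≤ 4 * ∫ x, ‖K x a b‖ ^ 2 ∂ν := by
    intro a ha b hb hab
    rw [← hf a ha b hb hab]
    have r := h.integral_reflection ha hb hab
      (f := fun A => (RCLike.re (A a a) - RCLike.re (A b b)) ^ 2) (by fun_prop)
    simp only [(conj_planeReflection_apply hab _).1, (conj_planeReflection_apply hab _).2,
      re_half_add, re_half_sub, (hherm _).re_apply_comm a b] at r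
    rw [← r, ← integral_const_mul]
    refine integral_mono (int (by fun_prop)) (int (by fun_prop)) fun x => ?_
    have := re_sq_le_norm_sq (K x a b)
    dsimp only
    nlinarith
  have hθ0 : 0 ≤ θ := integral_nonneg fun x => by positivity
  -- The diagonal terms of the squared Frobenius norm are dropped; `N² ≤ 2 N (N - 1)` makes up for
  -- it at the end.
  have hNθ : (S.card : ℝ) * (S.card - 1) * θ
      ≤ 4 * ∫ x, ∑ a ∈ S, ∑ b ∈ S, ‖K x a b‖ ^ 2 ∂ν := by
    rw [integral_finsetSum _ fun a _ => int (by fun_prop), Finset.mul_sum, mul_assoc,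
      ← nsmul_eq_mul, ← Finset.sum_const]
    refine Finset.sum_le_sum fun a ha => ?_
    rw [integral_finsetSum _ fun a _ => int (by fun_prop), Finset.mul_sum]
    have : ((S.card : ℝ) - 1) * θ = ∑ b ∈ S.erase a, θ := by
      rw [Finset.sum_const, Finset.card_erase_of_mem ha, nsmul_eq_mul, Nat.cast_sub (by omega),
        Nat.cast_one]
    rw [this]
    refine (Finset.sum_le_sum fun b hb => hθle a ha b (Finset.mem_of_mem_erase hb)
      (Finset.ne_of_mem_erase hb).symm).trans ?_
    refine Finset.sum_le_sum_of_subset_of_nonneg (Finset.erase_subset a S) fun b _ _ => ?_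
    exact mul_nonneg (by norm_num) (integral_nonneg fun x => by positivity)
  rw [h1]
  refine mul_le_mul_of_nonneg_right ?_ (Finset.sum_nonneg fun a _ => sq_nonneg _)
  have h4 : (2 : ℝ) ≤ S.card := by exact_mod_cast h2
  set N : ℝ := (S.card : ℝ)
  rw [div_mul_eq_mul_div (4 : ℝ), le_div_iff₀ (by positivity)]
  nlinarith [mul_nonneg (mul_nonneg (by linarith : (0 : ℝ) ≤ N) (by linarith : (0 : ℝ) ≤ N - 2)) hθ0]

/-- Centred quadratic forms in the squared moduli of the entries of an invariant matrix. -/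
theorem ConjInvariantOn.integral_sum_mul_norm_sq_le (h : ConjInvariantOn S ν K)
    (hK : Continuous K) {d : ι → ℝ} (hd : ∑ a ∈ S, d a = 0) {c : ι} (hc : c ∈ S) :
    ∫ x, ∑ a ∈ S, ∑ b ∈ S, d a * d b * ‖K x a b‖ ^ 2 ∂ν
      ≤ (∫ x, ‖K x c c‖ ^ 2 ∂ν) * ∑ a ∈ S, d a ^ 2 := by
  have int : ∀ {f : X → ℝ}, Continuous f → Integrable f ν := fun hf => hf.integrable_of_compactSpace
  rw [integral_finsetSum _ fun a _ => int (by fun_prop)]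
  have : ∀ a ∈ S, ∫ x, ∑ b ∈ S, d a * d b * ‖K x a b‖ ^ 2 ∂ν
      = ∑ b ∈ S, d a * d b * ∫ x, ‖K x a b‖ ^ 2 ∂ν := by
    intro a _
    rw [integral_finsetSum _ fun a _ => int (by fun_prop)]
    exact Finset.sum_congr rfl fun b _ => integral_const_mul _ _
  rw [Finset.sum_congr rfl this]
  have hα : ∀ a ∈ S, ∫ x, ‖K x a a‖ ^ 2 ∂ν = ∫ x, ‖K x c c‖ ^ 2 ∂ν := fun a ha =>
    h.integral_apply_diag hc ha (g := fun z => ‖z‖ ^ 2) (by fun_prop)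
  have hs0 : 0 ≤ ∑ a ∈ S, d a ^ 2 := Finset.sum_nonneg fun a _ => sq_nonneg _
  rcases Nat.lt_or_ge S.card 2 with h2 | h2
  · rw [sum_mul_mul_of_two_values (f := fun a b => ∫ x, ‖K x a b‖ ^ 2 ∂ν) hd (γ := 0) hα
      (fun a ha b hb hab => (hab (Finset.card_le_one.1 (by omega) a ha b hb)).elim), sub_zero]
  · obtain ⟨a₀, ha₀, b₀, hb₀, hab₀⟩ := Finset.one_lt_card.1 h2
    rw [sum_mul_mul_of_two_values (f := fun a b => ∫ x, ‖K x a b‖ ^ 2 ∂ν) hd hα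
      (fun a ha b hb hab => h.integral_apply_pair ha₀ hb₀ ha hb hab₀ hab
        (g := fun _ _ z => ‖z‖ ^ 2) (by fun_prop))]
    refine mul_le_mul_of_nonneg_right ?_ hs0
    have : 0 ≤ ∫ x, ‖K x a₀ b₀‖ ^ 2 ∂ν := integral_nonneg fun x => by positivity
    linarith

end ConjInvariantMoments

/-! ### Eigenmatrices of matrices with simple nonzero spectrum -/

section Eigenmatrix

variable {𝕜 : Type*} [RCLike 𝕜] {n m : ℕ}

theorem Matrix.conjTranspose_mul_self_of_mem_unitaryGroup {U : Matrix (Fin n) (Fin n) 𝕜}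
    (hU : U ∈ Matrix.unitaryGroup (Fin n) 𝕜) : Uᴴ * U = 1 :=
  Matrix.mem_unitaryGroup_iff'.1 hU

theorem Matrix.self_mul_conjTranspose_of_mem_unitaryGroup {U : Matrix (Fin n) (Fin n) 𝕜}
    (hU : U ∈ Matrix.unitaryGroup (Fin n) 𝕜) : U * Uᴴ = 1 :=
  Matrix.mem_unitaryGroup_iff.1 hU

theorem Monotone.eq_of_map_univ_eq {d d' : Fin n → ℝ} (hd : Monotone d) (hd' : Monotone d')
    (h : Multiset.map d Finset.univ.val = Multiset.map d' Finset.univ.val) : d = d' := by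
  rw [Fin.univ_val_map, Fin.univ_val_map, Multiset.coe_eq_coe] at h
  exact List.ofFn_injective (h.eq_of_sortedLE hd.sortedLE_ofFn hd'.sortedLE_ofFn)

/-- The roots of the characteristic polynomial give the eigenvalues with multiplicity, and a
multiset has only one monotone enumeration. -/
theorem eigenvalues_unique {A U U' : Matrix (Fin n) (Fin n) 𝕜}
    (hU : U ∈ Matrix.unitaryGroup (Fin n) 𝕜) (hU' : U' ∈ Matrix.unitaryGroup (Fin n) 𝕜)
    {d d' : Fin n → ℝ} (hd : Monotone d) (hd' : Monotone d')
    (hA : A = U * Matrix.diagonal (fun j => (d j : 𝕜)) * Uᴴ)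
    (hA' : A = U' * Matrix.diagonal (fun j => (d' j : 𝕜)) * U'ᴴ) : d = d' := by
  have key : ∀ {U : Matrix (Fin n) (Fin n) 𝕜} {d : Fin n → ℝ},
      U ∈ Matrix.unitaryGroup (Fin n) 𝕜 → A = U * Matrix.diagonal (fun j => (d j : 𝕜)) * Uᴴ →
      A.charpoly.roots = Multiset.map (fun j => (d j : 𝕜)) Finset.univ.val := by
    intro U d hU hA
    rw [hA, Matrix.charpoly_mul_comm, ← Matrix.mul_assoc,
      Matrix.conjTranspose_mul_self_of_mem_unitaryGroup hU, Matrix.one_mul,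
      Matrix.charpoly_diagonal, Finset.prod, ← Polynomial.roots_multiset_prod_X_sub_C
        (Multiset.map (fun j => (d j : 𝕜)) Finset.univ.val), Multiset.map_map]
    rfl
  have h := (key hU hA).symm.trans (key hU' hA')
  have h' := congrArg (Multiset.map (RCLike.re : 𝕜 → ℝ)) h
  simp only [Multiset.map_map, Function.comp_def, RCLike.ofReal_re] at h'
  exact hd.eq_of_map_univ_eq hd' h'

/-- The orthogonal projection onto the span of the columns of `U` with index in `B`. -/
def projOn (B : Finset (Fin n)) (U : Matrix (Fin n) (Fin n) 𝕜) : Matrix (Fin n) (Fin n) 𝕜 :=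
  Matrix.of fun i j => ∑ b ∈ B, U i b * star (U j b)

/-- Columns that belong to simple eigenvalues are determined up to a phase. -/
theorem mul_star_eq_of_simple {A U U' : Matrix (Fin n) (Fin n) 𝕜}
    (hU : U ∈ Matrix.unitaryGroup (Fin n) 𝕜) (hU' : U' ∈ Matrix.unitaryGroup (Fin n) 𝕜)
    {d : Fin n → ℝ} (hA : A = U * Matrix.diagonal (fun j => (d j : 𝕜)) * Uᴴ)
    (hA' : A = U' * Matrix.diagonal (fun j => (d j : 𝕜)) * U'ᴴ) {b : Fin n}
    (hb : ∀ a, a ≠ b → d a ≠ d b) (i j : Fin n) :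
    U i b * star (U j b) = U' i b * star (U' j b) := by
  have h1 := Matrix.conjTranspose_mul_self_of_mem_unitaryGroup hU
  have h1' := Matrix.conjTranspose_mul_self_of_mem_unitaryGroup hU'
  have h2 := Matrix.self_mul_conjTranspose_of_mem_unitaryGroup hU
  have h2' := Matrix.self_mul_conjTranspose_of_mem_unitaryGroup hU'
  set D : Matrix (Fin n) (Fin n) 𝕜 := Matrix.diagonal (fun j => (d j : 𝕜)) with hD
  set W := Uᴴ * U' with hW
  have hcomm : D * W = W * D := by
    have e1 : Uᴴ * A * U' = D * W := by
      rw [hA, hW]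
      calc Uᴴ * (U * D * Uᴴ) * U' = (Uᴴ * U) * D * (Uᴴ * U') := by simp only [Matrix.mul_assoc]
        _ = _ := by rw [h1, Matrix.one_mul]
    have e2 : Uᴴ * A * U' = W * D := by
      rw [hA', hW]
      calc Uᴴ * (U' * D * U'ᴴ) * U' = (Uᴴ * U') * D * (U'ᴴ * U') := by simp only [Matrix.mul_assoc]
        _ = _ := by rw [h1', Matrix.mul_one]
    rw [← e1, e2]
  -- Since `W` commutes with `D` and `d b` is simple, column `b` of `W` is supported at `b`; its one
  -- entry is a phase, which cancels in `U i b * star (U j b)`.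
  have hW0 : ∀ a, a ≠ b → W a b = 0 := by
    intro a hab
    have := congrFun (congrFun hcomm a) b
    rw [hD, Matrix.diagonal_mul, Matrix.mul_diagonal, mul_comm, ← sub_eq_zero, ← mul_sub] at this
    refine (mul_eq_zero.1 this).resolve_right ?_
    rw [← RCLike.ofReal_sub]
    exact fun h => sub_ne_zero.2 (hb a hab) (RCLike.ofReal_eq_zero.1 h)
  have hU'W : U' = U * W := by rw [hW, ← Matrix.mul_assoc, h2, Matrix.one_mul]
  have hcol : ∀ i, U' i b = U i b * W b b := by
    intro i
    rw [hU'W, Matrix.mul_apply, Finset.sum_eq_single b (fun a _ hab => by rw [hW0 a hab, mul_zero])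
      (by simp)]
  have hone : W b b * star (W b b) = 1 := by
    have hWW : Wᴴ * W = 1 := by
      rw [hW, Matrix.conjTranspose_mul, Matrix.conjTranspose_conjTranspose]
      calc U'ᴴ * U * (Uᴴ * U') = U'ᴴ * (U * Uᴴ) * U' := by simp only [Matrix.mul_assoc]
        _ = 1 := by rw [h2, Matrix.mul_one, h1']
    have := congrFun (congrFun hWW b) b
    rw [Matrix.mul_apply, Finset.sum_eq_single b (fun a _ hab => by rw [hW0 a hab, mul_zero])
      (by simp), Matrix.one_apply_eq, Matrix.conjTranspose_apply] at this
    rw [mul_comm]; exact this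
  rw [hcol, hcol, star_mul']
  linear_combination -(U i b * star (U j b)) * hone

theorem projOn_add_projOn_compl {U : Matrix (Fin n) (Fin n) 𝕜}
    (hU : U ∈ Matrix.unitaryGroup (Fin n) 𝕜) (B : Finset (Fin n)) :
    projOn B U + projOn Bᶜ U = 1 := by
  rw [← Matrix.self_mul_conjTranspose_of_mem_unitaryGroup hU]
  ext i j
  simp only [projOn, Matrix.add_apply, Matrix.of_apply, Matrix.mul_apply,
    Matrix.conjTranspose_apply]
  exact Finset.sum_add_sum_compl B _

/-- The determinant of the first `r` coordinates of the Krylov vectors `A v, …, A ^ r v`, where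
`v` has all coordinates one. -/
noncomputable def krylovMinor (r : ℕ) (hr : r ≤ n) (A : Matrix (Fin n) (Fin n) 𝕜) : 𝕜 :=
  (Matrix.of fun i j : Fin r =>
    (A ^ ((j : ℕ) + 1) *ᵥ (fun _ => (1 : 𝕜))) (Fin.castLE hr i)).det

theorem pow_mulVec_apply {A U : Matrix (Fin n) (Fin n) 𝕜}
    (hU : U ∈ Matrix.unitaryGroup (Fin n) 𝕜) {d : Fin n → ℝ}
    (hA : A = U * Matrix.diagonal (fun j => (d j : 𝕜)) * Uᴴ) (k : ℕ) (v : Fin n → 𝕜) (i : Fin n) :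
    (A ^ k *ᵥ v) i = ∑ a, U i a * ((d a : 𝕜) ^ k * (Uᴴ *ᵥ v) a) := by
  have hpow : A ^ k = U * Matrix.diagonal (fun j => (d j : 𝕜) ^ k) * Uᴴ := by
    induction k with
    | zero =>
      simp only [pow_zero]
      have : Matrix.diagonal (fun _ : Fin n => (1 : 𝕜)) = 1 := Matrix.diagonal_one
      rw [this, Matrix.mul_one, Matrix.self_mul_conjTranspose_of_mem_unitaryGroup hU]
    | succ k ih =>
      rw [pow_succ, ih]
      conv_lhs => rw [hA]
      calc U * Matrix.diagonal (fun j => (d j : 𝕜) ^ k) * Uᴴ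
            * (U * Matrix.diagonal (fun j => (d j : 𝕜)) * Uᴴ)
          = U * (Matrix.diagonal (fun j => (d j : 𝕜) ^ k) * (Uᴴ * U)
            * Matrix.diagonal (fun j => (d j : 𝕜))) * Uᴴ := by simp only [Matrix.mul_assoc]
        _ = _ := by
          rw [Matrix.conjTranspose_mul_self_of_mem_unitaryGroup hU, Matrix.mul_one,
            Matrix.diagonal_mul_diagonal]
          simp only [pow_succ]
  rw [hpow, ← Matrix.mulVec_mulVec, ← Matrix.mulVec_mulVec]
  simp [Matrix.mulVec, dotProduct, Matrix.diagonal_apply]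

/-- With fewer than `r` distinct nonzero eigenvalues, a polynomial `p` of degree below `r` vanishes
at all of them, and `A * p(A) = 0` is a linear relation among the Krylov vectors. So at least `r`
values are distinct, while the rank allows at most `r` nonzero eigenvalues. -/
theorem card_and_injOn_of_krylovMinor_ne_zero {r : ℕ} (hr : r ≤ n)
    {A U : Matrix (Fin n) (Fin n) 𝕜} (hU : U ∈ Matrix.unitaryGroup (Fin n) 𝕜) {d : Fin n → ℝ}
    (hA : A = U * Matrix.diagonal (fun j => (d j : 𝕜)) * Uᴴ) (hrank : A.rank ≤ r)
    (hk : krylovMinor r hr A ≠ 0) :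
    (Finset.univ.filter fun a => d a ≠ 0).card = r ∧
      Set.InjOn d (Finset.univ.filter fun a => d a ≠ 0 : Finset (Fin n)) := by
  classical
  set T := Finset.univ.filter fun a => d a ≠ 0 with hT
  have hTr : T.card ≤ r := by
    have hdet : IsUnit U.det := Matrix.UnitaryGroup.det_isUnit ⟨U, hU⟩
    have hdet' : IsUnit (Uᴴ).det := by rw [Matrix.det_conjTranspose]; exact hdet.star
    rw [hA, Matrix.rank_mul_eq_left_of_isUnit_det _ _ hdet',
      Matrix.rank_mul_eq_right_of_isUnit_det _ _ hdet, Matrix.rank_diagonal,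
      Fintype.card_subtype] at hrank
    simpa [hT] using hrank
  have hrT : r ≤ (T.image d).card := by
    by_contra! hlt
    apply hk
    set p : Polynomial 𝕜 := ∏ x ∈ T.image d, (Polynomial.X - Polynomial.C (x : 𝕜)) with hp
    have hpdeg : p.natDegree = (T.image d).card := by
      rw [hp, Polynomial.natDegree_prod_of_monic _ _ fun x _ => Polynomial.monic_X_sub_C _]
      simp
    have hpmonic : p.Monic := Polynomial.monic_prod_of_monic _ _ fun x _ => Polynomial.monic_X_sub_C _
    -- The coefficients of `p` are the kernel vector. The Krylov vectors start at `A v` rather than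
    -- `v`, and this extra factor `d a` disposes of the eigenvalue zero.
    refine Matrix.exists_mulVec_eq_zero_iff.1 ⟨fun j => p.coeff j, ?_, ?_⟩
    · intro h0
      have := congrFun h0 ⟨(T.image d).card, hlt⟩
      simp only [Pi.zero_apply] at this
      rw [← hpdeg, Polynomial.coeff_natDegree, hpmonic] at this
      exact one_ne_zero this
    · ext i
      simp only [Matrix.mulVec, dotProduct, Matrix.of_apply, Pi.zero_apply]
      have : ∀ j : Fin r, (∑ x, (A ^ ((j : ℕ) + 1)) (Fin.castLE hr i) x * 1) * p.coeff j
          = ∑ a, U (Fin.castLE hr i) a * ((Uᴴ *ᵥ fun _ => (1 : 𝕜)) a * (d a : 𝕜))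
              * (p.coeff j * (d a : 𝕜) ^ (j : ℕ)) := by
        intro j
        have e := pow_mulVec_apply hU hA ((j : ℕ) + 1) (fun _ => (1 : 𝕜)) (Fin.castLE hr i)
        simp only [Matrix.mulVec, dotProduct] at e ⊢
        rw [e, Finset.sum_mul]
        exact Finset.sum_congr rfl fun a _ => by ring
      rw [Finset.sum_congr rfl fun j _ => this j, Finset.sum_comm]
      refine Finset.sum_eq_zero fun a _ => ?_
      rw [← Finset.mul_sum]
      have heval : ∑ j : Fin r, p.coeff j * (d a : 𝕜) ^ (j : ℕ) = p.eval (d a : 𝕜) := by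
        rw [Polynomial.eval_eq_sum_range' (n := r) (by omega), Finset.sum_range]
      rw [heval]
      by_cases hda : d a = 0
      · simp [hda]
      · have : p.eval (d a : 𝕜) = 0 := by
          rw [hp, Polynomial.eval_prod]
          refine Finset.prod_eq_zero (i := d a) (Finset.mem_image_of_mem d (by simp [hT, hda])) ?_
          simp
        rw [this, mul_zero]
  have hle : (T.image d).card ≤ T.card := Finset.card_image_le
  refine ⟨by omega, ?_⟩
  exact Finset.card_image_iff.1 (by omega)

theorem eigenvalues_sampleCov_nonneg {M : Matrix (Fin n) (Fin m) 𝕜} {U : Matrix (Fin n) (Fin n) 𝕜}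
    (hU : U ∈ Matrix.unitaryGroup (Fin n) 𝕜) {d : Fin n → ℝ}
    (hA : sampleCov M = U * Matrix.diagonal (fun j => (d j : 𝕜)) * Uᴴ) (a : Fin n) : 0 ≤ d a := by
  have h1 := Matrix.conjTranspose_mul_self_of_mem_unitaryGroup hU
  have h2 : Uᴴ * sampleCov M * U = Matrix.diagonal (fun j => (d j : 𝕜)) := by
    rw [hA]
    calc Uᴴ * (U * Matrix.diagonal (fun j => (d j : 𝕜)) * Uᴴ) * U
        = (Uᴴ * U) * Matrix.diagonal (fun j => (d j : 𝕜)) * (Uᴴ * U) := by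
          simp only [Matrix.mul_assoc]
      _ = _ := by rw [h1, Matrix.one_mul, Matrix.mul_one]
  have h3 : Uᴴ * sampleCov M * U = ((m : 𝕜)⁻¹) • ((Uᴴ * M) * (Uᴴ * M)ᴴ) := by
    simp [sampleCov, Matrix.mul_assoc]
  rw [h3] at h2
  have h4 := congrFun (congrFun h2 a) a
  rw [Matrix.diagonal_apply_eq, Matrix.smul_apply, Matrix.mul_apply] at h4
  simp only [Matrix.conjTranspose_apply, RCLike.star_def, RCLike.mul_conj, smul_eq_mul] at h4
  have h5 : d a = (m : ℝ)⁻¹ * ∑ j, ‖(Uᴴ * M) a j‖ ^ 2 := by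
    have : (d a : 𝕜) = (((m : ℝ)⁻¹ * ∑ j, ‖(Uᴴ * M) a j‖ ^ 2 : ℝ) : 𝕜) := by
      rw [← h4]; push_cast; rfl
    exact_mod_cast this
  rw [h5]
  positivity

theorem rank_sampleCov_le (M : Matrix (Fin n) (Fin m) 𝕜) : (sampleCov M).rank ≤ min n m := by
  refine le_min (Matrix.rank_le_width _) ?_
  rw [sampleCov, ← Matrix.smul_mul]
  exact (Matrix.rank_mul_le_left _ _).trans (Matrix.rank_le_width _)

/-- The number of first columns of an eigenmatrix of `sampleCov M` that are not determined up to
phases, for typical `M`. -/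
def kernelDim (n m : ℕ) : ℕ := if m + 2 ≤ n then n - m else 0

theorem simple_of_krylovMinor_ne_zero {M : Matrix (Fin n) (Fin m) 𝕜}
    (hM : krylovMinor (min n m) (min_le_left n m) (sampleCov M) ≠ 0)
    {U : Matrix (Fin n) (Fin n) 𝕜} (hU : U ∈ Matrix.unitaryGroup (Fin n) 𝕜) {d : Fin n → ℝ}
    (hd : Monotone d) (hA : sampleCov M = U * Matrix.diagonal (fun j => (d j : 𝕜)) * Uᴴ)
    {b : Fin n} (hb : kernelDim n m ≤ b) (a : Fin n) (hab : a ≠ b) : d a ≠ d b := by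
  obtain ⟨hcard, hinj⟩ := card_and_injOn_of_krylovMinor_ne_zero (min_le_left n m) hU hA
    (rank_sampleCov_le M) hM
  have hd0 := eigenvalues_sampleCov_nonneg hU hA
  have hpos : ∀ c : Fin n, n - min n m ≤ c → d c ≠ 0 := by
    intro c hc h0
    -- The spectrum is nonnegative and sorted: if `d c = 0`, all nonzero eigenvalues have index
    -- above `c`, which leaves too few places for `min n m` of them.
    have : (Finset.univ.filter fun a => d a ≠ 0) ⊆ Finset.Ioi c := by
      intro a ha
      rw [Finset.mem_Ioi]
      by_contra! hle
      have := hd hle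
      exact (Finset.mem_filter.1 ha).2 (le_antisymm (h0 ▸ this) (hd0 a))
    have := Finset.card_le_card this
    rw [Fin.card_Ioi, hcard] at this
    have := c.2
    omega
  have hmem : ∀ c : Fin n, d c ≠ 0 →
      c ∈ ((Finset.univ.filter fun a => d a ≠ 0 : Finset (Fin n)) : Set (Fin n)) := by
    intro c hc; simp [hc]
  intro he
  by_cases h0 : d b = 0
  · have ha0 : d a = 0 := he.trans h0
    have h1 : ¬ n - min n m ≤ b := fun h => hpos b h h0
    have h2 : ¬ n - min n m ≤ a := fun h => hpos a h ha0
    have h3 : (a : ℕ) ≠ b := fun h => hab (Fin.ext h)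
    simp only [kernelDim] at hb
    -- Two distinct zero eigenvalues force `n - m ≥ 2`, and then `b` would lie below `kernelDim n
    -- m`. A kernel of dimension one is a simple eigenspace, consistent with `kernelDim n m = 0`
    -- when `n = m + 1`.
    split_ifs at hb <;> omega
  · exact hab (hinj (hmem a (he ▸ h0)) (hmem b h0) he)

theorem projOn_eq_of_krylovMinor_ne_zero {M : Matrix (Fin n) (Fin m) 𝕜}
    (hM : krylovMinor (min n m) (min_le_left n m) (sampleCov M) ≠ 0)
    {U U' : Matrix (Fin n) (Fin n) 𝕜} (hU : IsEigenmatrix (sampleCov M) U)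
    (hU' : IsEigenmatrix (sampleCov M) U') {B : Finset (Fin n)}
    (hB : (∀ b ∈ B, kernelDim n m ≤ b) ∨ ∀ b ∈ Bᶜ, kernelDim n m ≤ b) :
    projOn B U = projOn B U' := by
  obtain ⟨hUu, d, hd, hA⟩ := hU
  obtain ⟨hUu', d', hd', hA'⟩ := hU'
  obtain rfl := eigenvalues_unique hUu hUu' hd hd' hA hA'
  have key : ∀ B : Finset (Fin n), (∀ b ∈ B, kernelDim n m ≤ b) → projOn B U = projOn B U' := by
    intro B hB
    ext i j
    simp only [projOn, Matrix.of_apply]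
    exact Finset.sum_congr rfl fun b hb => mul_star_eq_of_simple hUu hUu' hA hA'
      (simple_of_krylovMinor_ne_zero hM hUu hd hA (hB b hb)) i j
  rcases hB with hB | hB
  · exact key B hB
  -- A projection that contains the undetermined kernel columns is fixed through its complement.
  · have h1 := projOn_add_projOn_compl hUu B
    have h2 := projOn_add_projOn_compl hUu' B
    rw [key Bᶜ hB, ← h2] at h1
    exact add_right_cancel h1

end Eigenmatrix

/-! ### Gaussian matrices -/

section Gaussian

theorem Measure.pi_absolutelyContinuous_fin {k : ℕ} {α : Type*} [MeasurableSpace α]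
    {μ ν : Fin k → Measure α} [∀ i, SigmaFinite (μ i)] [∀ i, SigmaFinite (ν i)]
    (h : ∀ i, μ i ≪ ν i) : Measure.pi μ ≪ Measure.pi ν := by
  induction k with
  | zero =>
    rw [Measure.pi_of_empty μ, Measure.pi_of_empty ν]
  | succ k ih =>
    have hμ := (measurePreserving_piFinSuccAbove μ 0).symm
    have hν := (measurePreserving_piFinSuccAbove ν 0).symm
    rw [← hμ.map_eq, ← hν.map_eq]
    exact ((h 0).prod (ih fun i => h _)).map (MeasurableEquiv.measurable _)

theorem Measure.pi_absolutelyContinuous {ι : Type*} [Fintype ι] {α : Type*} [MeasurableSpace α]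
    {μ ν : Measure α} [SigmaFinite μ] [SigmaFinite ν] (h : μ ≪ ν) :
    Measure.pi (fun _ : ι => μ) ≪ Measure.pi (fun _ : ι => ν) := by
  have e := (Fintype.equivFin ι).symm
  rw [← Measure.pi_map_piCongrLeft e (fun _ => μ), ← Measure.pi_map_piCongrLeft e (fun _ => ν)]
  exact (Measure.pi_absolutelyContinuous_fin fun _ => h).map (MeasurableEquiv.measurable _)

variable {𝕜 : Type*} [RCLike 𝕜] {n m : ℕ}

theorem continuous_krylovMinor (r : ℕ) (hr : r ≤ n) :
    Continuous (krylovMinor (𝕜 := 𝕜) r hr) := by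
  unfold krylovMinor
  refine Continuous.matrix_det ?_
  refine continuous_matrix fun i j => ?_
  simp only [Matrix.of_apply, Matrix.mulVec, dotProduct]
  fun_prop

theorem continuous_sampleCov :
    Continuous (sampleCov : Matrix (Fin n) (Fin m) 𝕜 → Matrix (Fin n) (Fin n) 𝕜) := by
  unfold sampleCov
  fun_prop

/-- Functions of a real variable that are given by a polynomial. -/
def IsPolynomialFun (𝕜 : Type*) [RCLike 𝕜] (f : ℝ → 𝕜) : Prop :=
  ∃ p : Polynomial 𝕜, ∀ t : ℝ, f t = p.eval (t : 𝕜)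

namespace IsPolynomialFun

theorem const (c : 𝕜) : IsPolynomialFun 𝕜 fun _ => c := ⟨Polynomial.C c, by simp⟩

theorem ofReal : IsPolynomialFun 𝕜 fun t => (t : 𝕜) := ⟨Polynomial.X, by simp⟩

theorem add {f g : ℝ → 𝕜} (hf : IsPolynomialFun 𝕜 f) (hg : IsPolynomialFun 𝕜 g) :
    IsPolynomialFun 𝕜 fun t => f t + g t := by
  obtain ⟨p, hp⟩ := hf
  obtain ⟨q, hq⟩ := hg
  exact ⟨p + q, fun t => by simp [hp, hq]⟩

theorem mul {f g : ℝ → 𝕜} (hf : IsPolynomialFun 𝕜 f) (hg : IsPolynomialFun 𝕜 g) :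
    IsPolynomialFun 𝕜 fun t => f t * g t := by
  obtain ⟨p, hp⟩ := hf
  obtain ⟨q, hq⟩ := hg
  exact ⟨p * q, fun t => by simp [hp, hq]⟩

theorem sum {ι : Type*} {s : Finset ι} {f : ι → ℝ → 𝕜} (hf : ∀ i, IsPolynomialFun 𝕜 (f i)) :
    IsPolynomialFun 𝕜 fun t => ∑ i ∈ s, f i t := by
  choose p hp using hf
  exact ⟨∑ i ∈ s, p i, fun t => by simp [hp, Polynomial.eval_finsetSum]⟩

theorem prod {ι : Type*} {s : Finset ι} {f : ι → ℝ → 𝕜} (hf : ∀ i, IsPolynomialFun 𝕜 (f i)) :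
    IsPolynomialFun 𝕜 fun t => ∏ i ∈ s, f i t := by
  choose p hp using hf
  exact ⟨∏ i ∈ s, p i, fun t => by simp [hp, Polynomial.eval_prod]⟩

theorem finite_zeros {f : ℝ → 𝕜} (hf : IsPolynomialFun 𝕜 f) {t₀ : ℝ} (h : f t₀ ≠ 0) :
    {t | f t = 0}.Finite := by
  obtain ⟨p, hp⟩ := hf
  have hp0 : p ≠ 0 := by rintro rfl; simp [hp] at h
  refine Set.Finite.subset ((p.roots.toFinset.finite_toSet).preimage
    (f := (fun t : ℝ => (t : 𝕜))) (RCLike.ofReal_injective.injOn)) fun t ht => ?_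
  simp only [Set.mem_preimage, Finset.mem_coe, Multiset.mem_toFinset]
  rw [Polynomial.mem_roots hp0, Polynomial.IsRoot.def, ← hp]
  exact ht

theorem mul_matrix {a b c : ℕ} {A : ℝ → Matrix (Fin a) (Fin b) 𝕜} {B : ℝ → Matrix (Fin b) (Fin c) 𝕜}
    (hA : ∀ i j, IsPolynomialFun 𝕜 fun t => A t i j)
    (hB : ∀ i j, IsPolynomialFun 𝕜 fun t => B t i j) (i : Fin a) (j : Fin c) :
    IsPolynomialFun 𝕜 fun t => (A t * B t) i j := by
  simp only [Matrix.mul_apply]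
  exact sum fun k => (hA i k).mul (hB k j)

theorem krylovMinor {A : ℝ → Matrix (Fin n) (Fin n) 𝕜}
    (hA : ∀ i j, IsPolynomialFun 𝕜 fun t => A t i j) (r : ℕ) (hr : r ≤ n) :
    IsPolynomialFun 𝕜 fun t => krylovMinor r hr (A t) := by
  have hpow : ∀ (k : ℕ) (i j : Fin n), IsPolynomialFun 𝕜 fun t => (A t ^ k) i j := by
    intro k
    induction k with
    | zero => intro i j; simp only [pow_zero]; exact const _
    | succ k ih => intro i j; simp only [pow_succ]; exact mul_matrix ih hA i j
  simp only [_root_.krylovMinor, Matrix.det_apply']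
  refine sum fun σ => (const _).mul (prod fun i => ?_)
  simp only [Matrix.of_apply, Matrix.mulVec, dotProduct]
  exact sum fun k => (hpow _ _ _).mul (const _)

end IsPolynomialFun

/-- Column `j` is multiplied by `c ^ (j + 1)`. This removes the factor `1/m` and allows rescaling
along a line. -/
theorem krylovMinor_smul (r : ℕ) (hr : r ≤ n) (c : 𝕜) (hc : c ≠ 0) (A : Matrix (Fin n) (Fin n) 𝕜) :
    krylovMinor r hr (c • A) = 0 ↔ krylovMinor r hr A = 0 := by
  have : krylovMinor r hr (c • A) = (∏ j : Fin r, c ^ ((j : ℕ) + 1)) * krylovMinor r hr A := by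
    rw [krylovMinor, krylovMinor, ← Matrix.det_mul_row]
    congr 1
    ext i j
    simp [smul_pow, Matrix.smul_mulVec]
  rw [this, mul_eq_zero]
  exact or_iff_right (Finset.prod_ne_zero_iff.2 fun j _ => pow_ne_zero _ hc)

/-- The matrix with diagonal entries `1, 2, …` and all other entries zero. -/
def stdDiagonal (𝕜 : Type*) [RCLike 𝕜] (n m : ℕ) : Matrix (Fin n) (Fin m) 𝕜 :=
  Matrix.of fun i j => if (i : ℕ) = j then ((i : ℕ) : 𝕜) + 1 else 0

/-- For this matrix the minor is a product of nonzero factors with the Vandermonde determinant of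
the distinct nodes `(i + 1)²`. -/
theorem krylovMinor_stdDiagonal_ne_zero :
    krylovMinor (min n m) (min_le_left n m)
      (stdDiagonal 𝕜 n m * (stdDiagonal 𝕜 n m)ᴴ) ≠ 0 := by
  set e : Fin n → 𝕜 := fun i => if (i : ℕ) < m then (((i : ℕ) : 𝕜) + 1) ^ 2 else 0 with he
  have hdiag : stdDiagonal 𝕜 n m * (stdDiagonal 𝕜 n m)ᴴ = Matrix.diagonal e := by
    ext i j
    simp only [Matrix.mul_apply, Matrix.conjTranspose_apply, stdDiagonal, Matrix.of_apply]
    by_cases hij : i = j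
    · subst hij
      rw [Matrix.diagonal_apply_eq, he]
      by_cases hi : (i : ℕ) < m
      · rw [Finset.sum_eq_single ⟨i, hi⟩]
        · simp [hi, sq]
        · intro k _ hk
          have : ¬ (i : ℕ) = k := fun h => hk (Fin.ext h.symm)
          simp [this]
        · simp
      · simp only [hi, if_false]
        refine Finset.sum_eq_zero fun k _ => ?_
        have : ¬ (i : ℕ) = k := fun h => hi (h ▸ k.2)
        simp [this]
    · rw [Matrix.diagonal_apply_ne _ hij]
      refine Finset.sum_eq_zero fun k _ => ?_
      by_cases h1 : (i : ℕ) = k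
      · have : ¬ (j : ℕ) = k := fun h => hij (Fin.ext (h1.trans h.symm))
        simp [this]
      · simp [h1]
  rw [hdiag, krylovMinor]
  have hmat : (Matrix.of fun i j : Fin (min n m) =>
      (Matrix.diagonal e ^ ((j : ℕ) + 1) *ᵥ (fun _ => (1 : 𝕜))) (Fin.castLE (min_le_left n m) i))
      = Matrix.of fun i j : Fin (min n m) => ((((i : ℕ) : 𝕜) + 1) ^ 2) *
          Matrix.vandermonde (fun i : Fin (min n m) => (((i : ℕ) : 𝕜) + 1) ^ 2) i j := by
    ext i j
    have hi : (i : ℕ) < m := lt_of_lt_of_le i.2 (min_le_right n m)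
    rw [Matrix.of_apply, Matrix.of_apply, Matrix.diagonal_pow, Matrix.mulVec_diagonal,
      Matrix.vandermonde_apply]
    simp [he, hi, pow_succ, mul_comm]
  rw [hmat, Matrix.det_mul_column]
  refine mul_ne_zero (Finset.prod_ne_zero_iff.2 fun i _ => ?_) ?_
  · exact pow_ne_zero _ (Nat.cast_add_one_ne_zero _)
  · rw [Matrix.det_vandermonde_ne_zero_iff]
    intro i j hij
    simp only at hij
    have h : (((i : ℕ) + 1) ^ 2 : ℕ) = ((j : ℕ) + 1) ^ 2 := by exact_mod_cast hij
    have := Nat.pow_left_injective (n := 2) (by norm_num) h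
    exact Fin.ext (by simpa using this)

/-- The matrix with real and imaginary parts `z`. -/
def complexify (𝕜 : Type*) [RCLike 𝕜] {n m : ℕ} (z : Fin n × Fin m → ℝ × ℝ) :
    Matrix (Fin n) (Fin m) 𝕜 :=
  Matrix.of fun i j => ((z (i, j)).1 : 𝕜) + ((z (i, j)).2 : 𝕜) * RCLike.I

theorem continuous_complexify : Continuous (complexify 𝕜 : (Fin n × Fin m → ℝ × ℝ) → _) := by
  refine continuous_matrix fun i j => ?_
  simp only [complexify, Matrix.of_apply]
  fun_prop

/-- On each line in the direction of the standard diagonal matrix the minor is a polynomial in the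
parameter. It is not identically zero, because that direction dominates at infinity. So each such
line meets the zero set in finitely many points, and the zero set is null. -/
theorem ae_krylovMinor_complexify_ne_zero (hm : 0 < m) :
    ∀ᵐ z : Fin n × Fin m → ℝ × ℝ,
      krylovMinor (min n m) (min_le_left n m) (sampleCov (complexify 𝕜 z)) ≠ 0 := by
  set N := stdDiagonal 𝕜 n m with hN
  set z₁ : Fin n × Fin m → ℝ × ℝ :=
    fun p => (if (p.1 : ℕ) = p.2 then ((p.1 : ℕ) : ℝ) + 1 else 0, 0) with hz₁
  have hmeas : MeasurableSet {z : Fin n × Fin m → ℝ × ℝ |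
      krylovMinor (min n m) (min_le_left n m) (sampleCov (complexify 𝕜 z)) ≠ 0} := by
    have hc : Continuous fun z : Fin n × Fin m → ℝ × ℝ =>
        krylovMinor (min n m) (min_le_left n m) (sampleCov (complexify 𝕜 z)) :=
      (continuous_krylovMinor _ _).comp (continuous_sampleCov.comp continuous_complexify)
    exact (isOpen_ne.preimage hc).measurableSet
  refine ae_mem_of_ae_add_linearMap_mem (LinearMap.toSpanSingleton ℝ _ z₁) volume volume hmeas ?_
  intro z
  set M := complexify 𝕜 z with hM
  -- With `s = 1 / t`, the point `t N + M` of the line equals `t (N + s M)`; behaviour at infinity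
  -- becomes the value at `s = 0`.
  set f : ℝ → 𝕜 := fun s =>
    krylovMinor (min n m) (min_le_left n m) (sampleCov (N + (s : 𝕜) • M)) with hf
  have hm' : (m : 𝕜)⁻¹ ≠ 0 := inv_ne_zero (Nat.cast_ne_zero.2 hm.ne')
  have hpoly : IsPolynomialFun 𝕜 f := by
    refine IsPolynomialFun.krylovMinor (fun i j => ?_) _ _
    simp only [sampleCov, Matrix.smul_apply, smul_eq_mul]
    refine (IsPolynomialFun.const _).mul (IsPolynomialFun.mul_matrix (fun i j => ?_)
      (fun i j => ?_) i j)
    · simp only [Matrix.add_apply, Matrix.smul_apply, smul_eq_mul]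
      exact (IsPolynomialFun.const _).add (IsPolynomialFun.ofReal.mul (IsPolynomialFun.const _))
    · simp only [Matrix.conjTranspose_apply, Matrix.add_apply, Matrix.smul_apply, smul_eq_mul,
        star_add, star_mul', RCLike.star_def, RCLike.conj_ofReal]
      exact (IsPolynomialFun.const _).add (IsPolynomialFun.ofReal.mul (IsPolynomialFun.const _))
  have hf0 : f 0 ≠ 0 := by
    simp only [hf, RCLike.ofReal_zero, zero_smul, add_zero, sampleCov]
    rw [Ne, krylovMinor_smul _ _ _ hm']
    exact krylovMinor_stdDiagonal_ne_zero
  have hfin := hpoly.finite_zeros hf0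
  have hbad : (({0} : Set ℝ) ∪ (fun t => t⁻¹) ⁻¹' {s | f s = 0}).Finite :=
    (Set.finite_singleton 0).union (hfin.preimage inv_injective.injOn)
  have hae : ∀ᵐ t : ℝ, t ∉ (({0} : Set ℝ) ∪ (fun t => t⁻¹) ⁻¹' {s | f s = 0}) :=
    measure_eq_zero_iff_ae_notMem.1 (hbad.measure_zero volume)
  filter_upwards [hae] with t ht
  simp only [Set.mem_union, Set.mem_singleton_iff, Set.mem_preimage, not_or] at ht
  obtain ⟨ht0, ht1⟩ := ht
  change krylovMinor _ _ (sampleCov (complexify 𝕜 (z + _))) ≠ 0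
  have ht' : (t : 𝕜) ≠ 0 := RCLike.ofReal_eq_zero.not.2 ht0
  have hexp : complexify 𝕜 (z + (LinearMap.toSpanSingleton ℝ _ z₁) t)
      = (t : 𝕜) • (N + ((t⁻¹ : ℝ) : 𝕜) • M) := by
    rw [smul_add, smul_smul, RCLike.ofReal_inv, mul_inv_cancel₀ ht', one_smul]
    ext i j
    simp only [complexify, hM, hN, stdDiagonal, Matrix.add_apply, Matrix.smul_apply,
      Matrix.of_apply, hz₁, LinearMap.toSpanSingleton_apply, Pi.add_apply, Pi.smul_apply,
      Prod.fst_add, Prod.snd_add, Prod.smul_mk, smul_eq_mul, mul_zero, add_zero]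
    split_ifs <;> push_cast <;> ring
  have hcov : ∀ (c : ℝ) (A : Matrix (Fin n) (Fin m) 𝕜),
      sampleCov ((c : 𝕜) • A) = ((c : 𝕜) * c) • sampleCov A := by
    intro c A
    simp only [sampleCov, Matrix.conjTranspose_smul, Matrix.smul_mul, Matrix.mul_smul, smul_smul,
      RCLike.star_def, RCLike.conj_ofReal]
    congr 1; ring
  rw [hexp, hcov, Ne, krylovMinor_smul _ _ _ (mul_ne_zero ht' ht')]
  exact ht1

end Gaussian

/-! ### Unitary invariance and absolute continuity of the Gaussian law -/

section GaussianLaw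

variable {𝕜 : Type*} [RCLike 𝕜] {n m : ℕ}

theorem measurable_ofReal_add_mul_I :
    Measurable fun p : ℝ × ℝ => (p.1 : 𝕜) + (p.2 : 𝕜) * RCLike.I := by
  have : Continuous fun p : ℝ × ℝ => (p.1 : 𝕜) + (p.2 : 𝕜) * RCLike.I := by fun_prop
  exact this.measurable

instance isProbabilityMeasure_stdGaussianLaw : IsProbabilityMeasure (stdGaussianLaw 𝕜) :=
  Measure.isProbabilityMeasure_map measurable_ofReal_add_mul_I.aemeasurable

/-- The dependence on `‖t‖` alone, over either field, is the source of the unitary invariance. -/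
theorem charFun_stdGaussianLaw (t : 𝕜) :
    charFun (stdGaussianLaw 𝕜) t
      = Complex.exp (-(((Module.finrank ℝ 𝕜 : ℝ)⁻¹ * ‖t‖ ^ 2 / 2 : ℝ) : ℂ)) := by
  have hinner : ∀ p : ℝ × ℝ, inner ℝ ((p.1 : 𝕜) + (p.2 : 𝕜) * RCLike.I) t
      = p.1 * RCLike.re t + p.2 * RCLike.im t := by
    intro p
    have h := RCLike.mul_im_I_ax t
    change RCLike.re (inner 𝕜 ((p.1 : 𝕜) + (p.2 : 𝕜) * RCLike.I) t) = _
    rw [RCLike.inner_apply, RCLike.mul_re]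
    simp [RCLike.mul_re, RCLike.mul_im]
    linear_combination p.2 * h
  rw [charFun_apply, stdGaussianLaw, integral_map measurable_ofReal_add_mul_I.aemeasurable]
  · simp_rw [hinner]
    have : ∀ p : ℝ × ℝ, Complex.exp (((p.1 * RCLike.re t + p.2 * RCLike.im t : ℝ) : ℂ) * Complex.I)
        = Complex.exp ((RCLike.re t : ℝ) * (p.1 : ℂ) * Complex.I)
          * Complex.exp ((RCLike.im t : ℝ) * (p.2 : ℂ) * Complex.I) := by
      intro p
      rw [← Complex.exp_add]
      congr 1
      push_cast; ring
    simp_rw [this]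
    rw [integral_prod_mul (fun x : ℝ => Complex.exp ((RCLike.re t : ℝ) * (x : ℂ) * Complex.I))
      (fun y : ℝ => Complex.exp ((RCLike.im t : ℝ) * (y : ℂ) * Complex.I)),
      ← charFun_apply_real, ← charFun_apply_real, charFun_gaussianReal, charFun_gaussianReal,
      ← Complex.exp_add]
    congr 1
    rw [RCLike.norm_sq_eq_def]
    push_cast
    ring
  · refine Continuous.aestronglyMeasurable ?_
    fun_prop


/-- The entries of `O * g`. -/
def leftMul (O : Matrix (Fin n) (Fin n) 𝕜) (g : Fin n × Fin m → 𝕜) : Fin n × Fin m → 𝕜 :=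
  fun p => ∑ k, O p.1 k * g (k, p.2)

theorem measurable_leftMul (O : Matrix (Fin n) (Fin n) 𝕜) :
    Measurable (leftMul O : (Fin n × Fin m → 𝕜) → _) := by
  have : Continuous (leftMul O : (Fin n × Fin m → 𝕜) → _) := by
    unfold leftMul
    fun_prop
  exact this.measurable

theorem real_inner_eq_re (z w : 𝕜) : inner ℝ z w = RCLike.re (w * star z) := by
  change RCLike.re (inner 𝕜 z w) = _
  rw [RCLike.inner_apply]
  rfl

theorem sum_inner_leftMul (O : Matrix (Fin n) (Fin n) 𝕜) (g t : Fin n × Fin m → 𝕜) :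
    ∑ p, inner ℝ (leftMul O g p) (t p) = ∑ p, inner ℝ (g p) (leftMul Oᴴ t p) := by
  simp only [real_inner_eq_re, leftMul, ← map_sum, Fintype.sum_prod_type, star_sum, star_mul',
    Finset.mul_sum, Finset.sum_mul, Matrix.conjTranspose_apply]
  congr 1
  rw [Finset.sum_comm]
  conv_rhs => rw [Finset.sum_comm]
  refine Finset.sum_congr rfl fun j _ => ?_
  rw [Finset.sum_comm]
  exact Finset.sum_congr rfl fun k _ => Finset.sum_congr rfl fun i _ => by ring

theorem leftMul_leftMul_conjTranspose {O : Matrix (Fin n) (Fin n) 𝕜}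
    (hO : O ∈ Matrix.unitaryGroup (Fin n) 𝕜) (t : Fin n × Fin m → 𝕜) :
    leftMul O (leftMul Oᴴ t) = t := by
  have key : ∀ (A : Matrix (Fin n) (Fin n) 𝕜) (s : Fin n × Fin m → 𝕜) (i : Fin n) (j : Fin m),
      leftMul A s (i, j) = (A *ᵥ fun k => s (k, j)) i := fun A s i j => rfl
  ext ⟨i, j⟩
  rw [key]
  simp_rw [key]
  change (O *ᵥ (Oᴴ *ᵥ fun k => t (k, j))) i = _
  rw [Matrix.mulVec_mulVec, Matrix.self_mul_conjTranspose_of_mem_unitaryGroup hO,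
    Matrix.one_mulVec]

theorem sum_norm_sq_leftMul_conjTranspose {O : Matrix (Fin n) (Fin n) 𝕜}
    (hO : O ∈ Matrix.unitaryGroup (Fin n) 𝕜) (t : Fin n × Fin m → 𝕜) :
    ∑ p, ‖leftMul Oᴴ t p‖ ^ 2 = ∑ p, ‖t p‖ ^ 2 := by
  have h := sum_inner_leftMul O (leftMul Oᴴ t) t
  rw [leftMul_leftMul_conjTranspose hO] at h
  simp only [real_inner_self_eq_norm_sq] at h
  exact h.symm

/-- The characteristic function of the product depends only on the sum of the `‖t p‖ ^ 2`, which
multiplication by the adjoint of `O` preserves. -/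
theorem pi_stdGaussianLaw_map_leftMul {O : Matrix (Fin n) (Fin n) 𝕜}
    (hO : O ∈ Matrix.unitaryGroup (Fin n) 𝕜) :
    (Measure.pi fun _ : Fin n × Fin m => stdGaussianLaw 𝕜).map (leftMul O)
      = Measure.pi fun _ : Fin n × Fin m => stdGaussianLaw 𝕜 := by
  set ρ := Measure.pi fun _ : Fin n × Fin m => stdGaussianLaw 𝕜 with hρ
  have : IsProbabilityMeasure (ρ.map (leftMul O)) :=
    Measure.isProbabilityMeasure_map (measurable_leftMul O).aemeasurable
  refine charFun_eq_pi_iff.1 fun t => ?_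
  have h1 : charFun ((ρ.map (leftMul O)).map (WithLp.toLp 2)) t
      = charFun (ρ.map (WithLp.toLp 2)) (WithLp.toLp 2 (leftMul Oᴴ t)) := by
    rw [charFun_apply, charFun_apply, integral_map (by fun_prop) (by fun_prop),
      integral_map (measurable_leftMul O).aemeasurable (by fun_prop),
      integral_map (by fun_prop) (by fun_prop)]
    refine integral_congr_ae (.of_forall fun g => ?_)
    simp only [PiLp.inner_apply]
    rw [sum_inner_leftMul]
  rw [h1, hρ, charFun_pi]
  simp_rw [charFun_stdGaussianLaw, ← Complex.exp_sum, Finset.sum_neg_distrib,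
    ← Complex.ofReal_sum, ← Finset.sum_div, ← Finset.mul_sum]
  rw [sum_norm_sq_leftMul_conjTranspose hO]

variable {Ω : Type*} [MeasurableSpace Ω] {μ : Measure Ω} [IsProbabilityMeasure μ]
  {M : Ω → Matrix (Fin n) (Fin m) 𝕜}

theorem IsGaussianMatrix.map_eq (hM : IsGaussianMatrix μ M) :
    μ.map (fun ω (p : Fin n × Fin m) => M ω p.1 p.2)
      = Measure.pi fun _ : Fin n × Fin m => stdGaussianLaw 𝕜 := by
  refine ((iIndepFun_iff_map_fun_eq_pi_map fun p : Fin n × Fin m => (hM.1 p.1 p.2).aemeasurable).1 hM.2.2).trans ?_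
  congr 1
  ext1 p
  exact hM.2.1 p.1 p.2

/-- The Gaussian law is pulled back to pairs of real coordinates, where it is absolutely continuous
over either field; for real matrices the second coordinate is mute. -/
theorem IsGaussianMatrix.ae_krylovMinor_ne_zero (hM : IsGaussianMatrix μ M) (hm : 0 < m) :
    ∀ᵐ ω ∂μ, krylovMinor (min n m) (min_le_left n m) (sampleCov (M ω)) ≠ 0 := by
  have hmeas : MeasurableSet {g : Fin n × Fin m → 𝕜 | krylovMinor (min n m) (min_le_left n m)
      (sampleCov (Matrix.of fun i j => g (i, j))) ≠ 0} := by
    have hc : Continuous fun g : Fin n × Fin m → 𝕜 => krylovMinor (min n m) (min_le_left n m)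
        (sampleCov (Matrix.of fun i j => g (i, j))) :=
      (continuous_krylovMinor _ _).comp (continuous_sampleCov.comp
        (continuous_matrix fun i j => by simp only [Matrix.of_apply]; fun_prop))
    exact (isOpen_ne.preimage hc).measurableSet
  have hmM : Measurable fun ω (p : Fin n × Fin m) => M ω p.1 p.2 :=
    measurable_pi_lambda _ fun p => hM.1 p.1 p.2
  have h := (ae_map_iff (μ := μ) hmM.aemeasurable hmeas).1
  refine h ?_
  set v : ℝ≥0 := (Module.finrank ℝ 𝕜 : ℝ≥0)⁻¹ with hv
  have hv0 : v ≠ 0 := inv_ne_zero (Nat.cast_ne_zero.2 Module.finrank_pos.ne')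
  have hpi : (Measure.pi fun _ : Fin n × Fin m => stdGaussianLaw 𝕜)
      = (Measure.pi fun _ : Fin n × Fin m => (gaussianReal 0 v).prod (gaussianReal 0 v)).map
        fun z p => ((z p).1 : 𝕜) + ((z p).2 : 𝕜) * RCLike.I := by
    have : ∀ _ : Fin n × Fin m, SigmaFinite (((gaussianReal 0 v).prod (gaussianReal 0 v)).map
        fun p : ℝ × ℝ => (p.1 : 𝕜) + (p.2 : 𝕜) * RCLike.I) := fun _ =>
      inferInstanceAs (SigmaFinite (stdGaussianLaw 𝕜))
    rw [Measure.pi_map_pi fun _ => measurable_ofReal_add_mul_I.aemeasurable]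
    rfl
  rw [hM.map_eq, hpi, ae_map_iff _ hmeas]
  · have hac : (Measure.pi fun _ : Fin n × Fin m => (gaussianReal 0 v).prod (gaussianReal 0 v))
        ≪ (volume : Measure (Fin n × Fin m → ℝ × ℝ)) :=
      Measure.pi_absolutelyContinuous
        ((gaussianReal_absolutelyContinuous 0 hv0).prod (gaussianReal_absolutelyContinuous 0 hv0))
    exact hac.ae_le (ae_krylovMinor_complexify_ne_zero hm)
  · exact (measurable_pi_lambda _ fun p =>
      measurable_ofReal_add_mul_I.comp (measurable_pi_apply p)).aemeasurable

theorem IsGaussianMatrix.map_mul_eq (hM : IsGaussianMatrix μ M) {O : Matrix (Fin n) (Fin n) 𝕜}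
    (hO : O ∈ Matrix.unitaryGroup (Fin n) 𝕜) :
    μ.map (fun ω (p : Fin n × Fin m) => (O * M ω) p.1 p.2)
      = μ.map (fun ω (p : Fin n × Fin m) => M ω p.1 p.2) := by
  have hmM : Measurable fun ω (p : Fin n × Fin m) => M ω p.1 p.2 :=
    measurable_pi_lambda _ fun p => hM.1 p.1 p.2
  have h := pi_stdGaussianLaw_map_leftMul (m := m) hO
  rw [← hM.map_eq, Measure.map_map (measurable_leftMul O) hmM] at h
  exact h

end GaussianLaw

/-! ### Laws of quantities determined through a relation -/

section Coupling

variable {α β γ Ω Ω' : Type*} [MeasurableSpace α] [MeasurableSpace β] [StandardBorelSpace β]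
  [Nonempty β] [MeasurableSpace γ] [MeasurableSpace Ω] [MeasurableSpace Ω']

/-- If `A` and `A'` have the same law and the value of `F` on `B` is determined by `A` through a
relation, then `F ∘ B` and `F ∘ B'` have the same law. -/
theorem map_comp_eq_of_relation {μ : Measure Ω} {μ' : Measure Ω'} [IsProbabilityMeasure μ]
    [IsProbabilityMeasure μ'] {A : Ω → α} {A' : Ω' → α} {B : Ω → β} {B' : Ω' → β}
    (hA : Measurable A) (hA' : Measurable A') (hB : Measurable B) (hB' : Measurable B')
    (hlaw : μ.map A = μ'.map A') {E : Set (α × β)} (hE : MeasurableSet E)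
    (h : ∀ᵐ ω ∂μ, (A ω, B ω) ∈ E) (h' : ∀ᵐ ω ∂μ', (A' ω, B' ω) ∈ E)
    {F : β → γ} (hF : Measurable F)
    (hFE : ∀ a b b', (a, b) ∈ E → (a, b') ∈ E → F b = F b') :
    μ.map (fun ω => F (B ω)) = μ'.map (fun ω => F (B' ω)) := by
  set ρ := μ.map fun ω => (A ω, B ω) with hρ
  set ρ' := μ'.map fun ω => (A' ω, B' ω) with hρ'
  have : IsProbabilityMeasure ρ := Measure.isProbabilityMeasure_map (hA.prodMk hB).aemeasurable
  have : IsProbabilityMeasure ρ' := Measure.isProbabilityMeasure_map (hA'.prodMk hB').aemeasurable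
  have hfst : ρ.fst = ρ'.fst := by
    rw [hρ, hρ', Measure.fst_map_prodMk hB, Measure.fst_map_prodMk hB', hlaw]
  -- Disintegration over the common law of `A` and `A'` avoids any measurable choice of `F b` as a
  -- function of `a`.
  have hρE : ∀ᵐ p ∂(ρ.fst ⊗ₘ ρ.condKernel), p ∈ E := by
    rw [ρ.disintegrate]; exact (ae_map_iff (hA.prodMk hB).aemeasurable hE).2 h
  have hρE' : ∀ᵐ p ∂(ρ'.fst ⊗ₘ ρ'.condKernel), p ∈ E := by
    rw [ρ'.disintegrate]; exact (ae_map_iff (hA'.prodMk hB').aemeasurable hE).2 h'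
  have h1 := Measure.ae_ae_of_ae_compProd hρE
  have h2 := Measure.ae_ae_of_ae_compProd hρE'
  rw [← hfst] at h2
  ext s hs
  have e1 : μ.map (fun ω => F (B ω)) s = ∫⁻ a, ρ.condKernel a (F ⁻¹' s) ∂ρ.fst := by
    rw [Measure.map_apply (show Measurable fun ω => F (B ω) from hF.comp hB) hs]
    have : ρ (Prod.snd ⁻¹' (F ⁻¹' s)) = ∫⁻ a, ρ.condKernel a (F ⁻¹' s) ∂ρ.fst := by
      conv_lhs => rw [← ρ.disintegrate ρ.condKernel]
      rw [Measure.compProd_apply (measurable_snd (hF hs))]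
      rfl
    rw [← this, hρ, Measure.map_apply (hA.prodMk hB) (measurable_snd (hF hs))]
    rfl
  have e2 : μ'.map (fun ω => F (B' ω)) s = ∫⁻ a, ρ'.condKernel a (F ⁻¹' s) ∂ρ'.fst := by
    rw [Measure.map_apply (show Measurable fun ω => F (B' ω) from hF.comp hB') hs]
    have : ρ' (Prod.snd ⁻¹' (F ⁻¹' s)) = ∫⁻ a, ρ'.condKernel a (F ⁻¹' s) ∂ρ'.fst := by
      conv_lhs => rw [← ρ'.disintegrate ρ'.condKernel]
      rw [Measure.compProd_apply (measurable_snd (hF hs))]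
      rfl
    rw [← this, hρ', Measure.map_apply (hA'.prodMk hB') (measurable_snd (hF hs))]
    rfl
  rw [e1, e2, ← hfst]
  refine lintegral_congr_ae ?_
  filter_upwards [h1, h2] with a ha ha'
  -- Given `a`, the value of `F` is almost surely `F b₀` under both conditional laws, so an event
  -- about it has probability 0 under both or 1 under both.
  obtain ⟨b₀, hb₀⟩ := ha.exists
  by_cases hs0 : F b₀ ∈ s
  · have g1 : ∀ᵐ b ∂ρ.condKernel a, b ∈ F ⁻¹' s := ha.mono fun b hb => by
      rw [Set.mem_preimage, hFE a b b₀ hb hb₀]; exact hs0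
    have g2 : ∀ᵐ b ∂ρ'.condKernel a, b ∈ F ⁻¹' s := ha'.mono fun b hb => by
      rw [Set.mem_preimage, hFE a b b₀ hb hb₀]; exact hs0
    rw [(mem_ae_iff_prob_eq_one (hF hs)).1 g1, (mem_ae_iff_prob_eq_one (hF hs)).1 g2]
  · have g1 : ∀ᵐ b ∂ρ.condKernel a, b ∉ F ⁻¹' s := ha.mono fun b hb => by
      rw [Set.mem_preimage, hFE a b b₀ hb hb₀]; exact hs0
    have g2 : ∀ᵐ b ∂ρ'.condKernel a, b ∉ F ⁻¹' s := ha'.mono fun b hb => by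
      rw [Set.mem_preimage, hFE a b b₀ hb hb₀]; exact hs0
    rw [measure_eq_zero_iff_ae_notMem.2 g1, measure_eq_zero_iff_ae_notMem.2 g2]

end Coupling

/-! ### Moments of the entries of invariant random unitary matrices -/

section UnitaryMoments

set_option linter.unusedSectionVars false

variable {𝕜 : Type*} [RCLike 𝕜] {n : ℕ}

theorem projOn_eq_mul (B : Finset (Fin n)) (U : Matrix (Fin n) (Fin n) 𝕜) :
    projOn B U = U * Matrix.diagonal (fun b => if b ∈ B then (1 : 𝕜) else 0) * Uᴴ := by
  ext i j
  rw [Matrix.mul_apply]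
  simp only [projOn, Matrix.of_apply, Matrix.mul_diagonal, Matrix.conjTranspose_apply, mul_ite,
    mul_one, mul_zero, ite_mul, zero_mul, Finset.sum_ite_mem, Finset.univ_inter]

theorem projOn_isHermitian (B : Finset (Fin n)) (U : Matrix (Fin n) (Fin n) 𝕜) :
    (projOn B U).IsHermitian := by
  ext i j
  simp [projOn, Matrix.conjTranspose_apply, mul_comm]

theorem projOn_apply_self (B : Finset (Fin n)) (U : Matrix (Fin n) (Fin n) 𝕜) (i : Fin n) :
    projOn B U i i = ((∑ b ∈ B, ‖U i b‖ ^ 2 : ℝ) : 𝕜) := by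
  simp [projOn, RCLike.mul_conj]

theorem norm_projOn_sq_le (B : Finset (Fin n)) (U : Matrix (Fin n) (Fin n) 𝕜) (i j : Fin n) :
    ‖projOn B U i j‖ ^ 2 ≤ (∑ b ∈ B, ‖U i b‖ ^ 2) * ∑ b ∈ B, ‖U j b‖ ^ 2 := by
  refine le_trans ?_ (Finset.sum_mul_sq_le_sq_mul_sq B (fun b => ‖U i b‖) fun b => ‖U j b‖)
  refine pow_le_pow_left₀ (norm_nonneg _) ?_ 2
  refine (norm_sum_le _ _).trans_eq (Finset.sum_congr rfl fun b _ => ?_)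
  rw [norm_mul, norm_star]

theorem sum_norm_sq_col {U : Matrix (Fin n) (Fin n) 𝕜}
    (hU : U ∈ Matrix.unitaryGroup (Fin n) 𝕜) (b : Fin n) : ∑ i, ‖U i b‖ ^ 2 = 1 := by
  have h := congrFun (congrFun (Matrix.conjTranspose_mul_self_of_mem_unitaryGroup hU) b) b
  rw [Matrix.mul_apply, Matrix.one_apply_eq] at h
  simp only [Matrix.conjTranspose_apply, RCLike.star_def, RCLike.conj_mul] at h
  exact_mod_cast h

theorem sum_norm_sq_projOn {U : Matrix (Fin n) (Fin n) 𝕜}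
    (hU : U ∈ Matrix.unitaryGroup (Fin n) 𝕜) (B : Finset (Fin n)) :
    ∑ i, ∑ j, ‖projOn B U i j‖ ^ 2 = B.card := by
  have hsq : projOn B U * (projOn B U)ᴴ = projOn B U := by
    rw [(projOn_isHermitian B U).eq, projOn_eq_mul]
    set D := Matrix.diagonal (fun b : Fin n => if b ∈ B then (1 : 𝕜) else 0)
    calc U * D * Uᴴ * (U * D * Uᴴ) = U * (D * (Uᴴ * U) * D) * Uᴴ := by simp only [Matrix.mul_assoc]
      _ = _ := by
        rw [Matrix.conjTranspose_mul_self_of_mem_unitaryGroup hU, Matrix.mul_one,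
          Matrix.diagonal_mul_diagonal]
        have : (fun i : Fin n => (if i ∈ B then (1 : 𝕜) else 0) * if i ∈ B then (1 : 𝕜) else 0)
            = fun i => if i ∈ B then (1 : 𝕜) else 0 := by
          ext i; split_ifs <;> simp
        rw [this]
  have key : ∀ i, ∑ j, ‖projOn B U i j‖ ^ 2 = ∑ b ∈ B, ‖U i b‖ ^ 2 := by
    intro i
    have h := congrFun (congrFun hsq i) i
    rw [Matrix.mul_apply, projOn_apply_self] at h
    simp only [Matrix.conjTranspose_apply, RCLike.star_def, RCLike.mul_conj] at h
    exact_mod_cast h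
  rw [Finset.sum_congr rfl fun i _ => key i, Finset.sum_comm,
    Finset.sum_congr rfl fun b _ => sum_norm_sq_col hU b]
  simp

/-- The compression of a real diagonal matrix to the columns of `U`. -/
def compression (d : Fin n → ℝ) (U : Matrix (Fin n) (Fin n) 𝕜) : Matrix (Fin n) (Fin n) 𝕜 :=
  Uᴴ * Matrix.diagonal (fun i => (d i : 𝕜)) * U

theorem compression_apply (d : Fin n → ℝ) (U : Matrix (Fin n) (Fin n) 𝕜) (a b : Fin n) :
    compression d U a b = ∑ i, (d i : 𝕜) * (star (U i a) * U i b) := by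
  rw [compression, Matrix.mul_apply]
  simp only [Matrix.mul_diagonal, Matrix.conjTranspose_apply]
  exact Finset.sum_congr rfl fun i _ => by ring

theorem compression_apply_self (d : Fin n → ℝ) (U : Matrix (Fin n) (Fin n) 𝕜) (a : Fin n) :
    compression d U a a = ((∑ i, d i * ‖U i a‖ ^ 2 : ℝ) : 𝕜) := by
  simp [compression_apply, RCLike.conj_mul]

theorem compression_isHermitian (d : Fin n → ℝ) (U : Matrix (Fin n) (Fin n) 𝕜) :
    (compression d U).IsHermitian := by
  ext a b
  simp [compression_apply, Matrix.conjTranspose_apply, mul_comm]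

theorem compression_single_apply (i : Fin n) (U : Matrix (Fin n) (Fin n) 𝕜) (a b : Fin n) :
    compression (Pi.single i 1) U a b = star (U i a) * U i b := by
  rw [compression_apply, Finset.sum_eq_single i]
  · simp
  · intro j _ hj; simp [Pi.single_eq_of_ne hj]
  · simp

/-- Both sides are `tr (P D P D)`, where `P` is `projOn S U`. The identity turns a right-invariant
quantity into one governed by left invariance. -/
theorem sum_norm_sq_compression (d : Fin n → ℝ) (U : Matrix (Fin n) (Fin n) 𝕜)
    (S : Finset (Fin n)) :
    ∑ a ∈ S, ∑ b ∈ S, ‖compression d U a b‖ ^ 2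
      = ∑ i, ∑ j, d i * d j * ‖projOn S U i j‖ ^ 2 := by
  have h : ((∑ a ∈ S, ∑ b ∈ S, ‖compression d U a b‖ ^ 2 : ℝ) : 𝕜)
      = ((∑ i, ∑ j, d i * d j * ‖projOn S U i j‖ ^ 2 : ℝ) : 𝕜) := by
    push_cast
    simp only [← RCLike.mul_conj, compression_apply, projOn, Matrix.of_apply, map_sum, map_mul,
      Finset.sum_mul_sum, RCLike.star_def, RCLike.conj_conj, RCLike.conj_ofReal]
    simp only [Finset.mul_sum]
    have e : ∀ f : Fin n → Fin n → Fin n → Fin n → 𝕜,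
        ∑ a ∈ S, ∑ b ∈ S, ∑ i, ∑ j, f a b i j = ∑ i, ∑ j, ∑ a ∈ S, ∑ b ∈ S, f a b i j := by
      intro f
      calc ∑ a ∈ S, ∑ b ∈ S, ∑ i, ∑ j, f a b i j = ∑ a ∈ S, ∑ i, ∑ b ∈ S, ∑ j, f a b i j :=
            Finset.sum_congr rfl fun a _ => Finset.sum_comm
        _ = ∑ i, ∑ a ∈ S, ∑ b ∈ S, ∑ j, f a b i j := Finset.sum_comm
        _ = ∑ i, ∑ a ∈ S, ∑ j, ∑ b ∈ S, f a b i j :=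
            Finset.sum_congr rfl fun i _ => Finset.sum_congr rfl fun a _ => Finset.sum_comm
        _ = _ := Finset.sum_congr rfl fun i _ => Finset.sum_comm
    rw [e]
    refine Finset.sum_congr rfl fun i _ => Finset.sum_congr rfl fun j _ => ?_
    conv_lhs => rw [Finset.sum_comm]
    exact Finset.sum_congr rfl fun a _ => Finset.sum_congr rfl fun b _ => by ring
  exact_mod_cast h

/-- The index set of the first `k` columns. -/
def firstCols (n k : ℕ) : Finset (Fin n) := Finset.univ.filter fun j => (j : ℕ) < k

theorem card_firstCols {k : ℕ} (hk : k ≤ n) : (firstCols n k).card = k := by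
  rw [firstCols, Fin.card_filter_val_lt, min_eq_right hk]

theorem continuous_projOn {Z : Type*} [TopologicalSpace Z]
    {U : Z → Matrix (Fin n) (Fin n) 𝕜} (hc : Continuous U) (B : Finset (Fin n)) :
    Continuous fun x => projOn B (U x) := by
  simp only [projOn_eq_mul]
  fun_prop

theorem continuous_compression {Z : Type*} [TopologicalSpace Z]
    {U : Z → Matrix (Fin n) (Fin n) 𝕜} (hc : Continuous U) (d : Fin n → ℝ) :
    Continuous fun x => compression d (U x) := by
  unfold compression
  fun_prop

variable {X : Type*} [TopologicalSpace X] [CompactSpace X] [MeasurableSpace X]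
  [OpensMeasurableSpace X] {ν : Measure X} [IsProbabilityMeasure ν]
  {U : X → Matrix (Fin n) (Fin n) 𝕜}

/-- The trace of the projection is the constant `B.card`, so the general bound becomes explicit. -/
theorem integral_projOn_pow_four_le (hc : Continuous U)
    (hU : ∀ x, U x ∈ Matrix.unitaryGroup (Fin n) 𝕜) {B : Finset (Fin n)}
    (hB : ConjInvariantOn Finset.univ ν fun x => projOn B (U x)) (i : Fin n) :
    ∫ x, (∑ b ∈ B, ‖U x i b‖ ^ 2) ^ 4 ∂ν ≤ 20 ^ 4 * (B.card : ℝ) ^ 4 / (n : ℝ) ^ 4 := by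
  have h := hB.integral_pow_four_le (continuous_projOn hc B) (fun x => projOn_isHermitian B _)
    (fun x a _ => by rw [projOn_apply_self, RCLike.ofReal_re]; positivity)
    (fun x a _ b _ => by
      simp only [projOn_apply_self, RCLike.ofReal_re]
      exact (re_sq_le_norm_sq _).trans (norm_projOn_sq_le B _ a b)) (Finset.mem_univ i)
  simp only [projOn_apply_self, RCLike.ofReal_re] at h
  refine h.trans_eq ?_
  have : ∀ x, ∑ a, ∑ b ∈ B, ‖U x a b‖ ^ 2 = B.card := by
    intro x
    rw [Finset.sum_comm, Finset.sum_congr rfl fun b _ => sum_norm_sq_col (hU x) b]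
    simp
  simp only [this, Finset.card_univ, Fintype.card_fin, integral_const, probReal_univ, one_smul]
  ring

/-- Eighth moment of an entry in the first `k` columns. -/
theorem integral_norm_pow_eight_le (hc : Continuous U)
    (hU : ∀ x, U x ∈ Matrix.unitaryGroup (Fin n) 𝕜) {k : ℕ} (hk : k ≤ n)
    (hL : ∀ B : Finset (Fin n), ((∀ b ∈ B, k ≤ b) ∨ ∀ b ∈ Bᶜ, k ≤ b) →
      ConjInvariantOn Finset.univ ν fun x => projOn B (U x))
    (hR : ∀ d : Fin n → ℝ, ConjInvariantOn (firstCols n k) ν fun x => compression d (U x))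
    (i j : Fin n) : ∫ x, ‖U x i j‖ ^ 8 ∂ν ≤ 20 ^ 8 / (n : ℝ) ^ 4 := by
  have hn : 0 < (n : ℝ) := by exact_mod_cast i.pos
  by_cases hj : k ≤ j
  · have h := integral_projOn_pow_four_le hc hU (hL {j} (Or.inl (by simpa using hj))) i
    simp only [Finset.sum_singleton, Finset.card_singleton, ← pow_mul] at h
    refine h.trans ?_
    gcongr
    norm_num
  · have hjS : j ∈ firstCols n k := by simp [firstCols]; omega
    -- The compression of the `i`-th coordinate projection has diagonal `‖U i a‖ ^ 2`, and its trace
    -- over the first `k` columns is the entry `(i, i)` of their projection. In the product of the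
    -- two bounds `k` cancels.
    have h1 := (hR (Pi.single i 1)).integral_pow_four_le (continuous_compression hc _)
      (fun x => compression_isHermitian _ _)
      (fun x a _ => by
        rw [compression_single_apply, RCLike.star_def, RCLike.conj_mul,
          ← RCLike.ofReal_pow, RCLike.ofReal_re]
        positivity)
      (fun x a _ b _ => by
        refine (re_sq_le_norm_sq _).trans ?_
        simp only [compression_single_apply, RCLike.star_def, RCLike.conj_mul, norm_mul,
          RCLike.norm_conj, ← RCLike.ofReal_pow, RCLike.ofReal_re, mul_pow]
        exact le_rfl) hjS
    simp only [compression_single_apply, RCLike.star_def, RCLike.conj_mul,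
      ← RCLike.ofReal_pow, RCLike.ofReal_re] at h1
    have h2 := integral_projOn_pow_four_le hc hU (hL (firstCols n k) (Or.inr
      (by simp [firstCols]))) i
    rw [card_firstCols hk] at h1 h2
    have hk0 : 0 < (k : ℝ) := by
      have : 0 < k := by omega
      exact_mod_cast this
    simp only [← pow_mul] at h1 ⊢
    calc _ ≤ _ := h1
      _ ≤ 20 ^ 4 / (k : ℝ) ^ 4 * (20 ^ 4 * (k : ℝ) ^ 4 / (n : ℝ) ^ 4) := by
          gcongr
      _ = _ := by field_simp

/-- The indicator of `A`, centred. -/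
noncomputable def centredIndicator (A : Finset (Fin n)) (i : Fin n) : ℝ :=
  (if i ∈ A then 1 else 0) - A.card / n

theorem sum_centredIndicator_mul (A : Finset (Fin n)) (f : Fin n → ℝ) :
    ∑ i, centredIndicator A i * f i = ∑ i ∈ A, f i - A.card / n * ∑ i, f i := by
  simp only [centredIndicator, sub_mul, Finset.sum_sub_distrib, ite_mul, one_mul, zero_mul,
    Finset.sum_ite_mem, Finset.univ_inter, Finset.mul_sum]

theorem sum_centredIndicator (hn : 0 < n) (A : Finset (Fin n)) :
    ∑ i, centredIndicator A i = 0 := by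
  have := sum_centredIndicator_mul A fun _ => 1
  simp only [mul_one] at this
  rw [this]
  have : (n : ℝ) ≠ 0 := by exact_mod_cast hn.ne'
  simp [this]

theorem sum_centredIndicator_sq_le (hn : 0 < n) (A : Finset (Fin n)) :
    ∑ i, centredIndicator A i ^ 2 ≤ A.card := by
  have h1 : ∑ i, centredIndicator A i ^ 2 = ∑ i ∈ A, centredIndicator A i := by
    have := sum_centredIndicator_mul A (centredIndicator A)
    rw [sum_centredIndicator hn, mul_zero, sub_zero] at this
    rw [← this]
    exact Finset.sum_congr rfl fun i _ => sq _
  rw [h1, ← nsmul_one, ← Finset.sum_const]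
  refine Finset.sum_le_sum fun i hi => ?_
  have : (0 : ℝ) ≤ A.card / n := by positivity
  simp only [centredIndicator, hi, if_true]
  linarith

/-- The block sum is a linear statistic of the diagonal of `projOn B U`. Because the trace is
constant, the indicator of `A` may be centred; the squared Frobenius norm is `B.card`. -/
theorem integral_sq_block_le_of_projOn (hc : Continuous U)
    (hU : ∀ x, U x ∈ Matrix.unitaryGroup (Fin n) 𝕜) {B : Finset (Fin n)}
    (hB : ConjInvariantOn Finset.univ ν fun x => projOn B (U x)) (hn : 0 < n)
    (A : Finset (Fin n)) :
    ∫ x, (∑ i ∈ A, ∑ j ∈ B, (‖U x i j‖ ^ 2 - 1 / (n : ℝ))) ^ 2 ∂ν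
      ≤ 4 * (A.card * B.card) / (n : ℝ) ^ 2 := by
  have h := hB.integral_sq_sum_le (continuous_projOn hc B) (fun x => projOn_isHermitian B _)
    (sum_centredIndicator hn A)
  simp only [projOn_apply_self, RCLike.ofReal_re, sum_norm_sq_projOn (hU _), integral_const,
    probReal_univ, one_smul, sum_centredIndicator_mul, Finset.card_univ, Fintype.card_fin] at h
  have e : ∀ x, ∑ i ∈ A, ∑ j ∈ B, (‖U x i j‖ ^ 2 - 1 / (n : ℝ))
      = ∑ i ∈ A, ∑ b ∈ B, ‖U x i b‖ ^ 2 - A.card / n * ∑ i, ∑ b ∈ B, ‖U x i b‖ ^ 2 := by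
    intro x
    rw [Finset.sum_comm (s := Finset.univ), Finset.sum_congr rfl fun b _ => sum_norm_sq_col (hU x) b]
    simp only [Finset.sum_sub_distrib, Finset.sum_const, nsmul_eq_mul]
    ring
  simp only [e]
  refine h.trans ?_
  calc _ ≤ 4 / (n : ℝ) ^ 2 * B.card * A.card := by
        gcongr
        exact sum_centredIndicator_sq_le hn A
    _ = _ := by ring

/-- On the kernel columns `S`, the indicator of `B` splits into a centred part and the constant
`B.card / k`. The centred part is a linear statistic of the diagonal of a compression; the constant
part is the block over all of `S`, a spectral projection. -/
theorem integral_sq_block_le_of_compression (hc : Continuous U)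
    (hU : ∀ x, U x ∈ Matrix.unitaryGroup (Fin n) 𝕜) {k : ℕ} (hk : k ≤ n)
    (hL : ConjInvariantOn Finset.univ ν fun x => projOn (firstCols n k) (U x))
    (hR : ∀ d : Fin n → ℝ, ConjInvariantOn (firstCols n k) ν fun x => compression d (U x))
    (A : Finset (Fin n)) {B : Finset (Fin n)} (hB : B ⊆ firstCols n k) :
    ∫ x, (∑ i ∈ A, ∑ j ∈ B, (‖U x i j‖ ^ 2 - 1 / (n : ℝ))) ^ 2 ∂ν
      ≤ 10 * 20 ^ 4 * (A.card * B.card) / (n : ℝ) ^ 2 := by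
  rcases B.eq_empty_or_nonempty with rfl | ⟨j₀, hj₀⟩
  · simp
  have int : ∀ {f : X → ℝ}, Continuous f → Integrable f ν := fun hf => hf.integrable_of_compactSpace
  have hn : 0 < n := j₀.pos
  have hn' : 0 < (n : ℝ) := by exact_mod_cast hn
  set S := firstCols n k with hS
  have hScard : S.card = k := card_firstCols hk
  have hk0 : 0 < (k : ℝ) := by
    have : 0 < S.card := Finset.card_pos.2 ⟨j₀, hB hj₀⟩
    rw [hScard] at this
    exact_mod_cast this
  have hBk : (B.card : ℝ) ≤ k := by rw [← hScard]; exact_mod_cast Finset.card_le_card hB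
  set d := centredIndicator A with hd
  set D : Fin n → X → ℝ := fun j x => ∑ i ∈ A, (‖U x i j‖ ^ 2 - 1 / (n : ℝ)) with hD
  have hdiag : ∀ x j, RCLike.re (compression d (U x) j j) = D j x := by
    intro x j
    rw [compression_apply_self, RCLike.ofReal_re, sum_centredIndicator_mul, sum_norm_sq_col (hU x)]
    simp only [hD, Finset.sum_sub_distrib, Finset.sum_const, nsmul_eq_mul]
    ring
  have cD : ∀ j, Continuous (D j) := fun j => by simp only [hD]; fun_prop
  set c : Fin n → ℝ := fun j => (if j ∈ B then 1 else 0) - B.card / k with hcdef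
  have hsumc : ∀ f : Fin n → ℝ, ∑ j ∈ S, c j * f j = ∑ j ∈ B, f j - B.card / k * ∑ j ∈ S, f j := by
    intro f
    simp only [hcdef, sub_mul, Finset.sum_sub_distrib, ite_mul, one_mul, zero_mul,
      Finset.sum_ite_mem, Finset.mul_sum, Finset.inter_eq_right.2 hB]
  have hc0 : ∑ j ∈ S, c j = 0 := by
    have := hsumc fun _ => 1
    simp only [mul_one, Finset.sum_const, nsmul_eq_mul, hScard] at this
    rw [this, div_mul_cancel₀ _ hk0.ne', sub_self]
  have hc2 : ∑ j ∈ S, c j ^ 2 ≤ B.card := by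
    have h1 : ∑ j ∈ S, c j ^ 2 = ∑ j ∈ B, c j := by
      have := hsumc c
      rw [hc0, mul_zero, sub_zero] at this
      rw [← this]
      exact Finset.sum_congr rfl fun i _ => sq _
    rw [h1, ← nsmul_one, ← Finset.sum_const]
    refine Finset.sum_le_sum fun i hi => ?_
    have : (0 : ℝ) ≤ B.card / k := by positivity
    simp only [hcdef, hi, if_true]
    linarith
  -- The second moment follows from the fourth by `2 x y ≤ x² + y²` with `x = (n / k) u²` and `y = k
  -- / n`, where `k / n` is the natural size of `u`.
  have hP2 : ∫ x, ‖projOn S (U x) j₀ j₀‖ ^ 2 ∂ν ≤ 20 ^ 4 * (k : ℝ) ^ 2 / (n : ℝ) ^ 2 := by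
    have h4 := integral_projOn_pow_four_le hc hU hL j₀
    rw [hScard] at h4
    have e : ∀ x, ‖projOn S (U x) j₀ j₀‖ = ∑ b ∈ S, ‖U x j₀ b‖ ^ 2 := by
      intro x
      rw [projOn_apply_self, RCLike.norm_ofReal, abs_of_nonneg (by positivity)]
    simp only [e]
    calc ∫ x, (∑ b ∈ S, ‖U x j₀ b‖ ^ 2) ^ 2 ∂ν
        ≤ ∫ x, ((n : ℝ) ^ 2 / k ^ 2 / 2 * (∑ b ∈ S, ‖U x j₀ b‖ ^ 2) ^ 4
            + (k : ℝ) ^ 2 / n ^ 2 / 2) ∂ν := by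
          refine integral_mono (int (by fun_prop)) (int (by fun_prop)) fun x => ?_
          dsimp only
          generalize ∑ b ∈ S, ‖U x j₀ b‖ ^ 2 = u
          have h := two_mul_le_add_sq ((n : ℝ) / k * u ^ 2) ((k : ℝ) / n)
          have e1 : (n : ℝ) / k * u ^ 2 * (k / n) = u ^ 2 := by field_simp
          have e2 : ((n : ℝ) / k * u ^ 2) ^ 2 = (n : ℝ) ^ 2 / k ^ 2 * u ^ 4 := by ring
          rw [mul_assoc, e1, e2, div_pow] at h
          linarith
      _ = (n : ℝ) ^ 2 / k ^ 2 / 2 * ∫ x, (∑ b ∈ S, ‖U x j₀ b‖ ^ 2) ^ 4 ∂ν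
            + (k : ℝ) ^ 2 / n ^ 2 / 2 := by
          rw [integral_add (int (by fun_prop)) (int (by fun_prop)), integral_const_mul]
          simp
      _ ≤ (n : ℝ) ^ 2 / k ^ 2 / 2 * (20 ^ 4 * (k : ℝ) ^ 4 / (n : ℝ) ^ 4)
            + (k : ℝ) ^ 2 / n ^ 2 / 2 := by gcongr
      _ = (20 ^ 4 + 1) / 2 * ((k : ℝ) ^ 2 / n ^ 2) := by field_simp
      _ ≤ 20 ^ 4 * ((k : ℝ) ^ 2 / n ^ 2) := by gcongr; norm_num
      _ = _ := by ring
  -- The expected squared Frobenius norm of the compression becomes a centred quadratic form in the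
  -- `‖P i j‖ ^ 2`, where left invariance leaves only a diagonal moment.
  have hF : ∫ x, ∑ a ∈ S, ∑ b ∈ S, ‖compression d (U x) a b‖ ^ 2 ∂ν
      ≤ 20 ^ 4 * (k : ℝ) ^ 2 / (n : ℝ) ^ 2 * A.card := by
    simp only [sum_norm_sq_compression]
    refine (hL.integral_sum_mul_norm_sq_le (continuous_projOn hc S) (sum_centredIndicator hn A)
      (Finset.mem_univ j₀)).trans ?_
    exact mul_le_mul hP2 (sum_centredIndicator_sq_le hn A)
      (Finset.sum_nonneg fun _ _ => sq_nonneg _) (by positivity)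
  have h1 := (hR d).integral_sq_sum_le (continuous_compression hc d)
    (fun x => compression_isHermitian _ _) hc0
  simp only [hdiag, hScard] at h1
  have h1' : ∫ x, (∑ a ∈ S, c a * D a x) ^ 2 ∂ν
      ≤ 4 * 20 ^ 4 * (A.card * B.card) / (n : ℝ) ^ 2 := by
    refine h1.trans ?_
    calc _ ≤ 4 / (k : ℝ) ^ 2 * (20 ^ 4 * (k : ℝ) ^ 2 / (n : ℝ) ^ 2 * A.card) * B.card := by
          gcongr
      _ = _ := by field_simp
  have h2 := integral_sq_block_le_of_projOn hc hU hL hn A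
  rw [hScard] at h2
  have hsw : ∀ (T : Finset (Fin n)) x,
      ∑ i ∈ A, ∑ j ∈ T, (‖U x i j‖ ^ 2 - 1 / (n : ℝ)) = ∑ j ∈ T, D j x := fun T x =>
    Finset.sum_comm
  simp only [hsw] at h2 ⊢
  calc ∫ x, (∑ j ∈ B, D j x) ^ 2 ∂ν
      ≤ ∫ x, (2 * (∑ a ∈ S, c a * D a x) ^ 2
          + 2 * (B.card / k) ^ 2 * (∑ j ∈ S, D j x) ^ 2) ∂ν := by
        refine integral_mono (int (by fun_prop)) (int (by fun_prop)) fun x => ?_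
        dsimp only
        have e := hsumc fun j => D j x
        have e' : ∑ j ∈ B, D j x = ∑ a ∈ S, c a * D a x + B.card / k * ∑ j ∈ S, D j x := by
          rw [e]; ring
        rw [e']
        nlinarith [sq_nonneg (∑ a ∈ S, c a * D a x - B.card / k * ∑ j ∈ S, D j x)]
    _ = 2 * ∫ x, (∑ a ∈ S, c a * D a x) ^ 2 ∂ν
          + 2 * (B.card / k) ^ 2 * ∫ x, (∑ j ∈ S, D j x) ^ 2 ∂ν := by
        rw [integral_add (int (by fun_prop)) (int (by fun_prop)), integral_const_mul,
          integral_const_mul]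
    _ ≤ 2 * (4 * 20 ^ 4 * (A.card * B.card) / (n : ℝ) ^ 2)
          + 2 * (B.card / k) ^ 2 * (4 * (A.card * k) / (n : ℝ) ^ 2) := by gcongr
    _ = (8 * 20 ^ 4 + 8 * (B.card / k)) * (A.card * B.card) / (n : ℝ) ^ 2 := by
        field_simp
        ring
    _ ≤ (8 * 20 ^ 4 + 8 * 1) * (A.card * B.card) / (n : ℝ) ^ 2 := by
        gcongr
        exact (div_le_one hk0).2 hBk
    _ ≤ _ := by gcongr; norm_num

/-- Second moments of block sums for invariant random unitary matrices. -/
theorem integral_sq_block_le (hc : Continuous U)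
    (hU : ∀ x, U x ∈ Matrix.unitaryGroup (Fin n) 𝕜) {k : ℕ} (hk : k ≤ n)
    (hL : ∀ B : Finset (Fin n), ((∀ b ∈ B, k ≤ b) ∨ ∀ b ∈ Bᶜ, k ≤ b) →
      ConjInvariantOn Finset.univ ν fun x => projOn B (U x))
    (hR : ∀ d : Fin n → ℝ, ConjInvariantOn (firstCols n k) ν fun x => compression d (U x))
    (hn : 0 < n) (A B : Finset (Fin n)) :
    ∫ x, (∑ i ∈ A, ∑ j ∈ B, (‖U x i j‖ ^ 2 - 1 / (n : ℝ))) ^ 2 ∂ν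
      ≤ 30 * 20 ^ 4 * (A.card * B.card) / (n : ℝ) ^ 2 := by
  have int : ∀ {f : X → ℝ}, Continuous f → Integrable f ν := fun hf => hf.integrable_of_compactSpace
  set S := firstCols n k with hS
  have hn' : 0 < (n : ℝ) := by exact_mod_cast hn
  -- The columns of `B` are split into kernel columns and columns of simple eigenvalues.
  have h0 := integral_sq_block_le_of_compression hc hU hk (hL S (Or.inr (by simp [hS, firstCols])))
    hR A (Finset.inter_subset_right : B ∩ S ⊆ S)
  have h1 := integral_sq_block_le_of_projOn hc hU (hL (B \ S) (Or.inl
    (by simp [hS, firstCols]))) hn A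
  set f : X → Fin n → Fin n → ℝ := fun x i j => ‖U x i j‖ ^ 2 - 1 / (n : ℝ) with hf
  have cf : ∀ i j, Continuous fun x => f x i j := fun i j => by simp only [hf]; fun_prop
  have hle0 : ((B ∩ S).card : ℝ) ≤ B.card := by
    exact_mod_cast Finset.card_le_card Finset.inter_subset_left
  have hle1 : ((B \ S).card : ℝ) ≤ B.card := by
    exact_mod_cast Finset.card_le_card Finset.sdiff_subset
  calc ∫ x, (∑ i ∈ A, ∑ j ∈ B, f x i j) ^ 2 ∂ν
      ≤ ∫ x, (2 * (∑ i ∈ A, ∑ j ∈ B ∩ S, f x i j) ^ 2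
          + 2 * (∑ i ∈ A, ∑ j ∈ B \ S, f x i j) ^ 2) ∂ν := by
        refine integral_mono (int (by fun_prop)) (int (by fun_prop)) fun x => ?_
        dsimp only
        have e : ∑ i ∈ A, ∑ j ∈ B, f x i j
            = ∑ i ∈ A, ∑ j ∈ B ∩ S, f x i j + ∑ i ∈ A, ∑ j ∈ B \ S, f x i j := by
          rw [← Finset.sum_add_distrib]
          exact Finset.sum_congr rfl fun i _ => (Finset.sum_inter_add_sum_sdiff B S _).symm
        rw [e]
        nlinarith [sq_nonneg (∑ i ∈ A, ∑ j ∈ B ∩ S, f x i j - ∑ i ∈ A, ∑ j ∈ B \ S, f x i j)]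
    _ = 2 * ∫ x, (∑ i ∈ A, ∑ j ∈ B ∩ S, f x i j) ^ 2 ∂ν
          + 2 * ∫ x, (∑ i ∈ A, ∑ j ∈ B \ S, f x i j) ^ 2 ∂ν := by
        rw [integral_add (int (by fun_prop)) (int (by fun_prop)), integral_const_mul,
          integral_const_mul]
    _ ≤ 2 * (10 * 20 ^ 4 * (A.card * B.card) / (n : ℝ) ^ 2)
          + 2 * (4 * (A.card * B.card) / (n : ℝ) ^ 2) := by
        refine add_le_add (mul_le_mul_of_nonneg_left (h0.trans ?_) (by norm_num))
          (mul_le_mul_of_nonneg_left (h1.trans ?_) (by norm_num)) <;> gcongr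
    _ = (20 * 20 ^ 4 + 8) * (A.card * B.card) / (n : ℝ) ^ 2 := by ring
    _ ≤ _ := by gcongr; norm_num

end UnitaryMoments

/-! ### Invariance of the eigenmatrices of Laguerre matrices -/

section LaguerreInvariance

set_option linter.unusedSectionVars false

variable {𝕜 : Type*} [RCLike 𝕜] {n m : ℕ}

/-- Without the quantifier over eigenvalues the conditions are visibly closed in `(A, U)`, which
makes the eigenmatrix relation measurable. -/
theorem isEigenmatrix_iff {A U : Matrix (Fin n) (Fin n) 𝕜} :
    IsEigenmatrix A U ↔ Uᴴ * U = 1 ∧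
      (∀ i j, i ≠ j → (Uᴴ * A * U) i j = 0) ∧ (∀ i, RCLike.im ((Uᴴ * A * U) i i) = 0) ∧
      ∀ i j, i ≤ j → RCLike.re ((Uᴴ * A * U) i i) ≤ RCLike.re ((Uᴴ * A * U) j j) := by
  constructor
  · rintro ⟨hU, d, hd, hA⟩
    have h1 := Matrix.conjTranspose_mul_self_of_mem_unitaryGroup hU
    have h2 : Uᴴ * A * U = Matrix.diagonal (fun j => (d j : 𝕜)) := by
      rw [hA]
      calc Uᴴ * (U * Matrix.diagonal (fun j => (d j : 𝕜)) * Uᴴ) * U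
          = (Uᴴ * U) * Matrix.diagonal (fun j => (d j : 𝕜)) * (Uᴴ * U) := by
            simp only [Matrix.mul_assoc]
        _ = _ := by rw [h1, Matrix.one_mul, Matrix.mul_one]
    refine ⟨h1, fun i j hij => ?_, fun i => ?_, fun i j hij => ?_⟩
    · rw [h2, Matrix.diagonal_apply_ne _ hij]
    · rw [h2, Matrix.diagonal_apply_eq, RCLike.ofReal_im]
    · rw [h2, Matrix.diagonal_apply_eq, Matrix.diagonal_apply_eq, RCLike.ofReal_re, RCLike.ofReal_re]
      exact hd hij
  · rintro ⟨h1, h2, h3, h4⟩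
    have hU : U ∈ Matrix.unitaryGroup (Fin n) 𝕜 := Matrix.mem_unitaryGroup_iff'.2 h1
    have h1' := Matrix.self_mul_conjTranspose_of_mem_unitaryGroup hU
    refine ⟨hU, fun i => RCLike.re ((Uᴴ * A * U) i i), fun i j hij => h4 i j hij, ?_⟩
    have : Matrix.diagonal (fun i => ((RCLike.re ((Uᴴ * A * U) i i) : ℝ) : 𝕜)) = Uᴴ * A * U := by
      ext i j
      by_cases hij : i = j
      · subst hij
        rw [Matrix.diagonal_apply_eq]
        apply RCLike.ext
        · rw [RCLike.ofReal_re]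
        · rw [RCLike.ofReal_im, h3]
      · rw [Matrix.diagonal_apply_ne _ hij, h2 i j hij]
    rw [this]
    calc A = (U * Uᴴ) * A * (U * Uᴴ) := by rw [h1', Matrix.one_mul, Matrix.mul_one]
      _ = _ := by simp only [Matrix.mul_assoc]

theorem isClosed_isEigenmatrix :
    IsClosed {p : Matrix (Fin n) (Fin n) 𝕜 × Matrix (Fin n) (Fin n) 𝕜 | IsEigenmatrix p.1 p.2} := by
  simp only [isEigenmatrix_iff, Set.ofPred_and, Set.ofPred_forall]
  refine IsClosed.inter (isClosed_eq (by fun_prop) (by fun_prop)) (IsClosed.inter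
    (isClosed_iInter fun i => isClosed_iInter fun j => isClosed_iInter fun _ =>
      isClosed_eq (by fun_prop) (by fun_prop)) (IsClosed.inter
    (isClosed_iInter fun i => isClosed_eq (by fun_prop) (by fun_prop))
    (isClosed_iInter fun i => isClosed_iInter fun j => isClosed_iInter fun _ =>
      isClosed_le (by fun_prop) (by fun_prop))))

theorem IsEigenmatrix.mul_left {M : Matrix (Fin n) (Fin m) 𝕜} {U O : Matrix (Fin n) (Fin n) 𝕜}
    (h : IsEigenmatrix (sampleCov M) U) (hO : O ∈ Matrix.unitaryGroup (Fin n) 𝕜) :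
    IsEigenmatrix (sampleCov (O * M)) (O * U) := by
  obtain ⟨hU, d, hd, hA⟩ := h
  refine ⟨mul_mem hO hU, d, hd, ?_⟩
  have : sampleCov (O * M) = O * sampleCov M * Oᴴ := by
    simp [sampleCov, Matrix.mul_assoc]
  rw [this, hA, Matrix.conjTranspose_mul]
  simp only [Matrix.mul_assoc]

theorem projOn_mul_left (B : Finset (Fin n)) (O U : Matrix (Fin n) (Fin n) 𝕜) :
    projOn B (O * U) = O * projOn B U * Oᴴ := by
  simp only [projOn_eq_mul, Matrix.conjTranspose_mul, Matrix.mul_assoc]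

theorem compression_mul_right (d : Fin n → ℝ) (U W : Matrix (Fin n) (Fin n) 𝕜) :
    compression d (U * W) = Wᴴ * compression d U * W := by
  simp only [compression, Matrix.conjTranspose_mul, Matrix.mul_assoc]

variable (𝕜 n) in
/-- Unitary matrices, as a compact measurable space. -/
abbrev UnitaryMatrix : Type _ := {U : Fin n → Fin n → 𝕜 // Matrix.of U ∈ Matrix.unitaryGroup (Fin n) 𝕜}

theorem isClosed_of_mem_unitaryGroup :
    IsClosed {U : Fin n → Fin n → 𝕜 | Matrix.of U ∈ Matrix.unitaryGroup (Fin n) 𝕜} := by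
  simp only [Matrix.mem_unitaryGroup_iff, Matrix.star_eq_conjTranspose]
  have : Continuous fun U : Fin n → Fin n → 𝕜 => Matrix.of U * (Matrix.of U)ᴴ := by
    have h : Continuous fun U : Fin n → Fin n → 𝕜 => Matrix.of U :=
      continuous_matrix fun i j => by simp only [Matrix.of_apply]; fun_prop
    fun_prop
  exact isClosed_eq this continuous_const

instance compactSpace_unitaryMatrix : CompactSpace (UnitaryMatrix 𝕜 n) := by
  refine isCompact_iff_compactSpace.1 (Metric.isCompact_of_isClosed_isBounded isClosed_of_mem_unitaryGroup ?_)
  refine (Metric.isBounded_closedBall (x := (0 : Fin n → Fin n → 𝕜)) (r := 1)).subset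
    fun U hU => ?_
  rw [mem_closedBall_zero_iff, pi_norm_le_iff_of_nonneg zero_le_one]
  intro i
  rw [pi_norm_le_iff_of_nonneg zero_le_one]
  exact fun j => entry_norm_bound_of_unitary hU i j

/-- The underlying matrix. -/
def UnitaryMatrix.toMatrix (x : UnitaryMatrix 𝕜 n) : Matrix (Fin n) (Fin n) 𝕜 := Matrix.of x.1

theorem UnitaryMatrix.continuous_toMatrix :
    Continuous (UnitaryMatrix.toMatrix : UnitaryMatrix 𝕜 n → Matrix (Fin n) (Fin n) 𝕜) :=
  continuous_matrix fun i j =>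
    (continuous_apply j).comp ((continuous_apply i).comp continuous_subtype_val)

variable {Ω : Type*} [MeasurableSpace Ω] {μ : Measure Ω} [IsProbabilityMeasure μ]

/-- Replacing `U` by the identity on a null set puts its law on a compact space, where every
continuous function is integrable. -/
theorem exists_measurable_unitaryMatrix {U : Ω → Matrix (Fin n) (Fin n) 𝕜}
    (hm : ∀ i j, Measurable fun ω => U ω i j)
    (hU : ∀ᵐ ω ∂μ, U ω ∈ Matrix.unitaryGroup (Fin n) 𝕜) :
    ∃ Y : Ω → UnitaryMatrix 𝕜 n, Measurable Y ∧ ∀ᵐ ω ∂μ, (Y ω).toMatrix = U ω := by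
  classical
  have hmU : Measurable fun ω (i j : Fin n) => U ω i j :=
    measurable_pi_lambda _ fun i => measurable_pi_lambda _ fun j => hm i j
  have hS : MeasurableSet {ω | U ω ∈ Matrix.unitaryGroup (Fin n) 𝕜} :=
    hmU isClosed_of_mem_unitaryGroup.measurableSet
  let f : Ω → Fin n → Fin n → 𝕜 := fun ω =>
    if U ω ∈ Matrix.unitaryGroup (Fin n) 𝕜 then fun i j => U ω i j
    else fun i j => (1 : Matrix (Fin n) (Fin n) 𝕜) i j
  have hf : Measurable f := Measurable.ite hS hmU measurable_const
  have hfU : ∀ ω, Matrix.of (f ω) ∈ Matrix.unitaryGroup (Fin n) 𝕜 := by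
    intro ω
    by_cases h : U ω ∈ Matrix.unitaryGroup (Fin n) 𝕜
    · simp only [f, h, if_true]; exact h
    · simp only [f, h, if_false]; exact one_mem _
  refine ⟨fun ω => ⟨f ω, hfU ω⟩, hf.subtype_mk, hU.mono fun ω h => ?_⟩
  simp only [UnitaryMatrix.toMatrix, f, h, if_true]
  rfl

variable {M : Ω → Matrix (Fin n) (Fin m) 𝕜} {U : Ω → Matrix (Fin n) (Fin n) 𝕜}
  {Y : Ω → UnitaryMatrix 𝕜 n}

theorem integral_map_unitaryMatrix (hY : Measurable Y) (hYU : ∀ᵐ ω ∂μ, (Y ω).toMatrix = U ω)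
    {f : Matrix (Fin n) (Fin n) 𝕜 → ℝ} (hf : Continuous f) :
    ∫ x, f x.toMatrix ∂(μ.map Y) = ∫ ω, f (U ω) ∂μ := by
  have hc : Continuous fun x : UnitaryMatrix 𝕜 n => f x.toMatrix :=
    hf.comp UnitaryMatrix.continuous_toMatrix
  rw [integral_map hY.aemeasurable hc.aestronglyMeasurable]
  exact integral_congr_ae (hYU.mono fun ω h => by simp only [h])

/-- Left invariance of the spectral projections of a Laguerre matrix. -/
theorem conjInvariantOn_projOn (hM : IsGaussianMatrix μ M) (hm : 0 < m)
    (hU : IsMeasurableEigenmatrix μ (fun ω => sampleCov (M ω)) U)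
    (hY : Measurable Y) (hYU : ∀ᵐ ω ∂μ, (Y ω).toMatrix = U ω) {B : Finset (Fin n)}
    (hB : (∀ b ∈ B, kernelDim n m ≤ b) ∨ ∀ b ∈ Bᶜ, kernelDim n m ≤ b) :
    ConjInvariantOn Finset.univ (μ.map Y) fun x => projOn B x.toMatrix := by
  intro W hW _ f hf
  have hO : Wᴴ ∈ Matrix.unitaryGroup (Fin n) 𝕜 := by
    rw [Matrix.mem_unitaryGroup_iff', Matrix.star_eq_conjTranspose,
      Matrix.conjTranspose_conjTranspose]
    exact Matrix.self_mul_conjTranspose_of_mem_unitaryGroup hW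
  have hc : Continuous fun U : Matrix (Fin n) (Fin n) 𝕜 => f (projOn B U) :=
    hf.comp (continuous_projOn continuous_id B)
  have hc' : Continuous fun U : Matrix (Fin n) (Fin n) 𝕜 => f (Wᴴ * projOn B U * W) := by
    have := continuous_projOn (U := fun U : Matrix (Fin n) (Fin n) 𝕜 => U) continuous_id B
    fun_prop
  rw [integral_map_unitaryMatrix hY hYU hc, integral_map_unitaryMatrix hY hYU hc']
  have hproj : ∀ ω, Wᴴ * projOn B (U ω) * W = projOn B (Wᴴ * U ω) := by
    intro ω
    rw [projOn_mul_left, Matrix.conjTranspose_conjTranspose]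
  simp only [hproj]
  have hofg : Continuous fun g : Fin n × Fin m → 𝕜 => Matrix.of fun i j => g (i, j) :=
    continuous_matrix fun i j => by simp only [Matrix.of_apply]; fun_prop
  have hofu : Continuous fun u : Fin n → Fin n → 𝕜 => Matrix.of u :=
    continuous_matrix fun i j => by simp only [Matrix.of_apply]; fun_prop
  set G : Set (Fin n × Fin m → 𝕜) := {g | krylovMinor (min n m) (min_le_left n m)
      (sampleCov (Matrix.of fun i j => g (i, j))) ≠ 0} with hG
  have hGm : MeasurableSet G :=
    (isOpen_ne.preimage ((continuous_krylovMinor _ _).comp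
      (continuous_sampleCov.comp hofg))).measurableSet
  set E : Set ((Fin n × Fin m → 𝕜) × (Fin n → Fin n → 𝕜)) :=
    {p | p.1 ∈ G ∧ IsEigenmatrix (sampleCov (Matrix.of fun i j => p.1 (i, j))) (Matrix.of p.2)}
    with hE
  have hEm : MeasurableSet E := by
    refine (measurable_fst hGm).inter (IsClosed.measurableSet ?_)
    refine isClosed_isEigenmatrix.preimage (f := fun p : (Fin n × Fin m → 𝕜) × (Fin n → Fin n → 𝕜) =>
      (sampleCov (Matrix.of fun i j => p.1 (i, j)), Matrix.of p.2)) ?_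
    exact (continuous_sampleCov.comp (hofg.comp continuous_fst)).prodMk (hofu.comp continuous_snd)
  have hmM : Measurable fun ω (p : Fin n × Fin m) => M ω p.1 p.2 :=
    measurable_pi_lambda _ fun p => hM.1 p.1 p.2
  have hmOM : Measurable fun ω (p : Fin n × Fin m) => (Wᴴ * M ω) p.1 p.2 :=
    (measurable_leftMul Wᴴ).comp hmM
  have hmU : Measurable fun ω (i j : Fin n) => U ω i j :=
    measurable_pi_lambda _ fun i => measurable_pi_lambda _ fun j => hU.1 i j
  have hmOU : Measurable fun ω (i j : Fin n) => (Wᴴ * U ω) i j := by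
    refine measurable_pi_lambda _ fun i => measurable_pi_lambda _ fun j => ?_
    simp only [Matrix.mul_apply]
    exact Finset.measurable_sum _ fun k _ => (hU.1 k j).const_mul _
  have hlaw := hM.map_mul_eq hO
  have hgood : ∀ᵐ ω ∂μ, (fun p : Fin n × Fin m => M ω p.1 p.2) ∈ G :=
    hM.ae_krylovMinor_ne_zero hm
  have hgood' : ∀ᵐ ω ∂μ, (fun p : Fin n × Fin m => (Wᴴ * M ω) p.1 p.2) ∈ G := by
    have h1 := (ae_map_iff hmM.aemeasurable hGm).2 hgood
    rw [← hlaw] at h1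
    exact (ae_map_iff hmOM.aemeasurable hGm).1 h1
  have hE1 : ∀ᵐ ω ∂μ, ((fun p : Fin n × Fin m => (Wᴴ * M ω) p.1 p.2),
      (fun i j => (Wᴴ * U ω) i j)) ∈ E := by
    filter_upwards [hgood', hU.2] with ω h1 h2
    exact ⟨h1, h2.mul_left hO⟩
  have hE2 : ∀ᵐ ω ∂μ, ((fun p : Fin n × Fin m => M ω p.1 p.2), (fun i j => U ω i j)) ∈ E := by
    filter_upwards [hgood, hU.2] with ω h1 h2
    exact ⟨h1, h2⟩
  have hFm : Measurable fun u : Fin n → Fin n → 𝕜 => f (projOn B (Matrix.of u)) :=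
    (hc.comp hofu).measurable
  -- `Wᴴ * U` is an eigenmatrix for `Wᴴ * M`, as `U` is for `M`. The two data matrices have the same
  -- law, and on `E` the projection depends on the data matrix only, whichever eigenmatrix was
  -- chosen.
  have key := map_comp_eq_of_relation hmOM hmM hmOU hmU hlaw hEm hE1 hE2 hFm
    fun a b b' h h' => congrArg f (projOn_eq_of_krylovMinor_ne_zero h.1 h.2 h'.2 hB)
  have e1 := integral_map (μ := μ) (hFm.comp hmOU).aemeasurable
    (f := fun t : ℝ => t) aestronglyMeasurable_id
  have e2 := integral_map (μ := μ) (hFm.comp hmU).aemeasurable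
    (f := fun t : ℝ => t) aestronglyMeasurable_id
  have key' : μ.map ((fun u : Fin n → Fin n → 𝕜 => f (projOn B (Matrix.of u))) ∘
        fun ω (i j : Fin n) => (Wᴴ * U ω) i j)
      = μ.map ((fun u : Fin n → Fin n → 𝕜 => f (projOn B (Matrix.of u))) ∘
        fun ω (i j : Fin n) => U ω i j) := key
  rw [key', e2] at e1
  exact e1.symm

/-- Right invariance of the kernel basis of a Laguerre matrix. -/
theorem conjInvariantOn_compression (hM : IsGaussianMatrix μ M)
    (hU : IsMeasurableEigenmatrix μ (fun ω => sampleCov (M ω)) U)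
    (hker : KernelBasisUniform μ M U)
    (hY : Measurable Y) (hYU : ∀ᵐ ω ∂μ, (Y ω).toMatrix = U ω) (d : Fin n → ℝ) :
    ConjInvariantOn (firstCols n (kernelDim n m)) (μ.map Y)
      fun x => compression d x.toMatrix := by
  intro W hW hWS f hf
  by_cases hnm : m + 2 ≤ n
  · have hk : kernelDim n m = n - m := if_pos hnm
    have hc : Continuous fun U : Matrix (Fin n) (Fin n) 𝕜 => f (compression d U) :=
      hf.comp (continuous_compression continuous_id d)
    have hc' : Continuous fun U : Matrix (Fin n) (Fin n) 𝕜 => f (Wᴴ * compression d U * W) := by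
      have := continuous_compression (U := fun U : Matrix (Fin n) (Fin n) 𝕜 => U) continuous_id d
      fun_prop
    rw [integral_map_unitaryMatrix hY hYU hc, integral_map_unitaryMatrix hY hYU hc']
    simp only [← compression_mul_right]
    have hlaw := hker hnm W hW fun i j hj => hWS i j (by simp [firstCols, hk]; omega)
    have hofu : Continuous fun u : Fin n → Fin n → 𝕜 => Matrix.of u :=
      continuous_matrix fun i j => by simp only [Matrix.of_apply]; fun_prop
    have hFm : Continuous fun p : (Fin n → Fin m → 𝕜) × (Fin n → Fin n → 𝕜) =>
        f (compression d (Matrix.of p.2)) := hc.comp (hofu.comp continuous_snd)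
    have hmM : Measurable fun ω (i : Fin n) (j : Fin m) => M ω i j :=
      measurable_pi_lambda _ fun i => measurable_pi_lambda _ fun j => hM.1 i j
    have hmU : Measurable fun ω (i j : Fin n) => U ω i j :=
      measurable_pi_lambda _ fun i => measurable_pi_lambda _ fun j => hU.1 i j
    have hmUW : Measurable fun ω (i j : Fin n) => (U ω * W) i j := by
      refine measurable_pi_lambda _ fun i => measurable_pi_lambda _ fun j => ?_
      simp only [Matrix.mul_apply]
      exact Finset.measurable_sum _ fun k _ => (hU.1 i k).mul_const _
    have e1 := integral_map (μ := μ) (hmM.prodMk hmUW).aemeasurable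
      (hFm.measurable.aestronglyMeasurable)
    have e2 := integral_map (μ := μ) (hmM.prodMk hmU).aemeasurable
      (hFm.measurable.aestronglyMeasurable)
    rw [hlaw, e2] at e1
    exact e1.symm
  -- For `n ≤ m + 1` no column may be mixed, and `W` is the identity.
  · have hk : kernelDim n m = 0 := if_neg hnm
    have hW1 : W = 1 := by
      ext i j
      exact hWS i j (by simp [firstCols, hk])
    rw [hW1]
    simp

theorem kernelDim_le (n m : ℕ) : kernelDim n m ≤ n := by
  unfold kernelDim; split_ifs <;> omega

theorem UnitaryMatrix.toMatrix_mem (x : UnitaryMatrix 𝕜 n) :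
    x.toMatrix ∈ Matrix.unitaryGroup (Fin n) 𝕜 := x.2

theorem laguerre_integral_norm_pow_eight_le (hM : IsGaussianMatrix μ M) (hm : 0 < m)
    (hU : IsMeasurableEigenmatrix μ (fun ω => sampleCov (M ω)) U)
    (hker : KernelBasisUniform μ M U) (i j : Fin n) :
    ∫ ω, ‖U ω i j‖ ^ 8 ∂μ ≤ 20 ^ 8 / (n : ℝ) ^ 4 := by
  obtain ⟨Y, hY, hYU⟩ := exists_measurable_unitaryMatrix hU.1 (hU.2.mono fun ω h => h.1)
  have : IsProbabilityMeasure (μ.map Y) := Measure.isProbabilityMeasure_map hY.aemeasurable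
  rw [← integral_map_unitaryMatrix hY hYU (f := fun A => ‖A i j‖ ^ 8) (by fun_prop)]
  exact integral_norm_pow_eight_le UnitaryMatrix.continuous_toMatrix UnitaryMatrix.toMatrix_mem
    (kernelDim_le n m) (fun B hB => conjInvariantOn_projOn hM hm hU hY hYU hB)
    (fun d => conjInvariantOn_compression hM hU hker hY hYU d) i j

theorem laguerre_integral_sq_block_le (hM : IsGaussianMatrix μ M) (hm : 0 < m)
    (hU : IsMeasurableEigenmatrix μ (fun ω => sampleCov (M ω)) U)
    (hker : KernelBasisUniform μ M U) (hn : 0 < n) (A B : Finset (Fin n)) :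
    ∫ ω, (∑ i ∈ A, ∑ j ∈ B, (‖U ω i j‖ ^ 2 - 1 / (n : ℝ))) ^ 2 ∂μ
      ≤ 30 * 20 ^ 4 * (A.card * B.card) / (n : ℝ) ^ 2 := by
  obtain ⟨Y, hY, hYU⟩ := exists_measurable_unitaryMatrix hU.1 (hU.2.mono fun ω h => h.1)
  have : IsProbabilityMeasure (μ.map Y) := Measure.isProbabilityMeasure_map hY.aemeasurable
  rw [← integral_map_unitaryMatrix hY hYU
    (f := fun U => (∑ i ∈ A, ∑ j ∈ B, (‖U i j‖ ^ 2 - 1 / (n : ℝ))) ^ 2) (by fun_prop)]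
  exact integral_sq_block_le UnitaryMatrix.continuous_toMatrix UnitaryMatrix.toMatrix_mem
    (kernelDim_le n m) (fun B hB => conjInvariantOn_projOn hM hm hU hY hYU hB)
    (fun d => conjInvariantOn_compression hM hU hker hY hYU d) hn A B

end LaguerreInvariance

/-! ### Control of jumps -/

section Jumps

set_option linter.unusedSectionVars false

variable {𝕜 : Type*} [RCLike 𝕜] {n : ℕ} {Ω : Type*} [MeasurableSpace Ω] {μ : Measure Ω}
  [IsProbabilityMeasure μ] {U : Ω → Matrix (Fin n) (Fin n) 𝕜}

theorem memLp_of_continuous_of_unitary (hm : ∀ i j, Measurable fun ω => U ω i j)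
    (hU : ∀ᵐ ω ∂μ, U ω ∈ Matrix.unitaryGroup (Fin n) 𝕜) {f : Matrix (Fin n) (Fin n) 𝕜 → ℝ}
    (hf : Continuous f) (p : ℝ≥0∞) : MemLp (fun ω => f (U ω)) p μ := by
  obtain ⟨Y, hY, hYU⟩ := exists_measurable_unitaryMatrix hm hU
  have : IsProbabilityMeasure (μ.map Y) := Measure.isProbabilityMeasure_map hY.aemeasurable
  have hc : Continuous fun x : UnitaryMatrix 𝕜 n => f x.toMatrix :=
    hf.comp UnitaryMatrix.continuous_toMatrix
  have h1 : MemLp (fun x : UnitaryMatrix 𝕜 n => f x.toMatrix) p (μ.map Y) :=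
    hc.memLp_of_hasCompactSupport (HasCompactSupport.of_compactSpace _)
  have h2 := (memLp_map_measure_iff hc.aestronglyMeasurable hY.aemeasurable).1 h1
  exact h2.ae_eq (hYU.mono fun ω h => by simp only [Function.comp_apply, h])

theorem integrable_of_continuous_of_unitary (hm : ∀ i j, Measurable fun ω => U ω i j)
    (hU : ∀ᵐ ω ∂μ, U ω ∈ Matrix.unitaryGroup (Fin n) 𝕜) {f : Matrix (Fin n) (Fin n) 𝕜 → ℝ}
    (hf : Continuous f) : Integrable (fun ω => f (U ω)) μ :=
  memLp_one_iff_integrable.1 (memLp_of_continuous_of_unitary hm hU hf 1)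

theorem eLpNorm_le_of_integral_pow_le {f : Ω → ℝ} {q : ℕ} (hq : Even q) (hq0 : q ≠ 0)
    (hf : MemLp f q μ) {K : ℝ} (hK : ∫ ω, f ω ^ q ∂μ ≤ K) :
    eLpNorm f q μ ≤ ((K ^ (q : ℝ)⁻¹).toNNReal : ℝ≥0∞) := by
  rw [hf.eLpNorm_eq_integral_rpow_norm (by exact_mod_cast hq0) (by simp)]
  simp only [ENNReal.toReal_natCast, Real.rpow_natCast, Real.norm_eq_abs, hq.pow_abs]
  refine ENNReal.ofReal_le_ofReal (Real.rpow_le_rpow ?_ hK (by positivity))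
  exact integral_nonneg fun ω => hq.pow_nonneg _

theorem mul_mul_star_sub_one (z : 𝕜) :
    (n : 𝕜) * z * star z - 1 = (((n : ℝ) * ‖z‖ ^ 2 - 1 : ℝ) : 𝕜) := by
  push_cast
  rw [mul_assoc, RCLike.star_def, RCLike.mul_conj]

theorem laguerre_integral_sub_one_pow_four_le {m : ℕ} {M : Ω → Matrix (Fin n) (Fin m) 𝕜}
    (hM : IsGaussianMatrix μ M) (hm : 0 < m)
    (hU : IsMeasurableEigenmatrix μ (fun ω => sampleCov (M ω)) U)
    (hker : KernelBasisUniform μ M U) (i j : Fin n) :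
    ∫ ω, ((n : ℝ) * ‖U ω i j‖ ^ 2 - 1) ^ 4 ∂μ ≤ 8 * (20 ^ 8 + 1) := by
  have hu : ∀ᵐ ω ∂μ, U ω ∈ Matrix.unitaryGroup (Fin n) 𝕜 := hU.2.mono fun ω h => h.1
  have hn : 0 < (n : ℝ) := by exact_mod_cast i.pos
  calc ∫ ω, ((n : ℝ) * ‖U ω i j‖ ^ 2 - 1) ^ 4 ∂μ
      ≤ ∫ ω, (8 * (n : ℝ) ^ 4 * ‖U ω i j‖ ^ 8 + 8) ∂μ := by
        refine integral_mono
          (integrable_of_continuous_of_unitary hU.1 hu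
            (f := fun A => ((n : ℝ) * ‖A i j‖ ^ 2 - 1) ^ 4) (by fun_prop))
          (integrable_of_continuous_of_unitary hU.1 hu
            (f := fun A => 8 * (n : ℝ) ^ 4 * ‖A i j‖ ^ 8 + 8) (by fun_prop)) fun ω => ?_
        have e : 8 * (n : ℝ) ^ 4 * ‖U ω i j‖ ^ 8 = 8 * ((n : ℝ) * ‖U ω i j‖ ^ 2) ^ 4 := by ring
        dsimp only
        rw [e]
        generalize (n : ℝ) * ‖U ω i j‖ ^ 2 = a
        nlinarith [sq_nonneg (a + 1), sq_nonneg (a ^ 2 - 1), sq_nonneg (a ^ 2 + a),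
          sq_nonneg (a ^ 2 + a + 1), mul_nonneg (sq_nonneg (a + 1)) (sq_nonneg a),
          sq_nonneg (a * (a + 1)), sq_nonneg (a ^ 2 + 2 * a + 1)]
    _ = 8 * (n : ℝ) ^ 4 * ∫ ω, ‖U ω i j‖ ^ 8 ∂μ + 8 := by
        rw [integral_add (integrable_of_continuous_of_unitary hU.1 hu
            (f := fun A => 8 * (n : ℝ) ^ 4 * ‖A i j‖ ^ 8) (by fun_prop)) (integrable_const _),
          integral_const_mul]
        simp
    _ ≤ 8 * (n : ℝ) ^ 4 * (20 ^ 8 / (n : ℝ) ^ 4) + 8 := by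
        gcongr
        exact laguerre_integral_norm_pow_eight_le hM hm hU hker i j
    _ = _ := by field_simp

/-- The count is at most a difference of floors. The extra 1 is later absorbed, as blocks have sides
of length at least `1 / n`. -/
theorem card_blockIndices_le {s s' : ℝ} (hss : s ≤ s') :
    ((blockIndices n s s').card : ℝ) ≤ n * (s' - s) + 1 := by
  have h1 : (blockIndices n s s').card ≤ (Finset.Ioc ⌊(n : ℝ) * s⌋ ⌊(n : ℝ) * s'⌋).card := by
    refine Finset.card_le_card_of_injOn (fun i => ((i : ℕ) : ℤ) + 1) (fun i hi => ?_)
      (fun i _ j _ hij => ?_)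
    · have hi' : (n : ℝ) * s < ((i : ℕ) : ℝ) + 1 ∧ ((i : ℕ) : ℝ) + 1 ≤ (n : ℝ) * s' := by
        simpa [blockIndices] using hi
      simp only [Finset.coe_Ioc, Set.mem_Ioc]
      refine ⟨Int.floor_lt.2 ?_, Int.le_floor.2 ?_⟩
      · push_cast; exact hi'.1
      · push_cast; exact hi'.2
    · simp only [add_left_inj, Nat.cast_inj] at hij
      exact Fin.ext hij
  have hns : (n : ℝ) * s ≤ n * s' := by gcongr
  rw [Int.card_Ioc] at h1
  have h2 : ((⌊(n : ℝ) * s'⌋ - ⌊(n : ℝ) * s⌋).toNat : ℝ) = ⌊(n : ℝ) * s'⌋ - ⌊(n : ℝ) * s⌋ := by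
    have : ((⌊(n : ℝ) * s'⌋ - ⌊(n : ℝ) * s⌋).toNat : ℤ) = ⌊(n : ℝ) * s'⌋ - ⌊(n : ℝ) * s⌋ :=
      Int.toNat_of_nonneg (sub_nonneg.2 (Int.floor_le_floor hns))
    exact_mod_cast this
  have h3 : ((blockIndices n s s').card : ℝ) ≤ ⌊(n : ℝ) * s'⌋ - ⌊(n : ℝ) * s⌋ := by
    rw [← h2]; exact_mod_cast h1
  have h4 := Int.floor_le ((n : ℝ) * s')
  have h5 := Int.lt_floor_add_one ((n : ℝ) * s)
  linarith

theorem sq_sum_sum_eq (A : Matrix (Fin n) (Fin n) 𝕜) (hn : 0 < n) (I J : Finset (Fin n)) :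
    (n : ℝ) ^ 2 * (∑ i ∈ I, ∑ j ∈ J, (‖A i j‖ ^ 2 - 1 / (n : ℝ))) ^ 2
      = ∑ p ∈ I ×ˢ J, ∑ q ∈ I ×ˢ J,
        ((n : ℝ) * ‖A p.1 p.2‖ ^ 2 - 1) * ((n : ℝ) * ‖A q.1 q.2‖ ^ 2 - 1) := by
  have hn' : (n : ℝ) ≠ 0 := by exact_mod_cast hn.ne'
  rw [← Finset.sum_mul_sum, ← sq, ← mul_pow, Finset.sum_product, Finset.mul_sum]
  congr 1
  refine Finset.sum_congr rfl fun i _ => ?_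
  rw [Finset.mul_sum]
  refine Finset.sum_congr rfl fun j _ => ?_
  field_simp

theorem sq_mul_integral_sq_block_eq (hm : ∀ i j, Measurable fun ω => U ω i j)
    (hU : ∀ᵐ ω ∂μ, U ω ∈ Matrix.unitaryGroup (Fin n) 𝕜) (hn : 0 < n) (I J : Finset (Fin n)) :
    (n : ℝ) ^ 2 * ∫ ω, (∑ i ∈ I, ∑ j ∈ J, (‖U ω i j‖ ^ 2 - 1 / (n : ℝ))) ^ 2 ∂μ
      = ∑ p ∈ I ×ˢ J, ∑ q ∈ I ×ˢ J, ∫ ω, ((n : ℝ) * ‖U ω p.1 p.2‖ ^ 2 - 1)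
        * ((n : ℝ) * ‖U ω q.1 q.2‖ ^ 2 - 1) ∂μ := by
  have hint : ∀ p q : Fin n × Fin n, Integrable (fun ω => ((n : ℝ) * ‖U ω p.1 p.2‖ ^ 2 - 1)
      * ((n : ℝ) * ‖U ω q.1 q.2‖ ^ 2 - 1)) μ := fun p q =>
    integrable_of_continuous_of_unitary hm hU (f := fun A => ((n : ℝ) * ‖A p.1 p.2‖ ^ 2 - 1)
      * ((n : ℝ) * ‖A q.1 q.2‖ ^ 2 - 1)) (by fun_prop)
  rw [← integral_const_mul]
  simp_rw [sq_sum_sum_eq _ hn]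
  rw [integral_finsetSum _ fun p _ => integrable_finsetSum _ fun q _ => hint p q]
  exact Finset.sum_congr rfl fun p _ => integral_finsetSum _ fun q _ => hint p q

end Jumps

/-! ### Comparison of block sums and conclusion -/

section Comparison

variable {𝕜 : Type*} [RCLike 𝕜] {n : ℕ} {Ω Ω' : Type*} [MeasurableSpace Ω] [MeasurableSpace Ω']
  {μ : Measure Ω} [IsProbabilityMeasure μ] {μ' : Measure Ω'} [IsProbabilityMeasure μ']
  {U : Ω → Matrix (Fin n) (Fin n) 𝕜} {U' : Ω' → Matrix (Fin n) (Fin n) 𝕜}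

/-- The square is a double sum over pairs of entries, and each of the `(I.card * J.card) ^ 2` pairs
costs at most `ε`. -/
theorem integral_sq_block_le_add (hm : ∀ i j, Measurable fun ω => U ω i j)
    (hU : ∀ᵐ ω ∂μ, U ω ∈ Matrix.unitaryGroup (Fin n) 𝕜)
    (hm' : ∀ i j, Measurable fun ω => U' ω i j)
    (hU' : ∀ᵐ ω ∂μ', U' ω ∈ Matrix.unitaryGroup (Fin n) 𝕜) {ε : ℝ}
    (h : ∀ p q : Fin n × Fin n,
      |∫ ω, ((n : ℝ) * ‖U ω p.1 p.2‖ ^ 2 - 1) * ((n : ℝ) * ‖U ω q.1 q.2‖ ^ 2 - 1) ∂μ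
        - ∫ ω, ((n : ℝ) * ‖U' ω p.1 p.2‖ ^ 2 - 1) * ((n : ℝ) * ‖U' ω q.1 q.2‖ ^ 2 - 1) ∂μ'| ≤ ε)
    (hn : 0 < n) (I J : Finset (Fin n)) :
    ∫ ω, (∑ i ∈ I, ∑ j ∈ J, (‖U ω i j‖ ^ 2 - 1 / (n : ℝ))) ^ 2 ∂μ
      ≤ ∫ ω, (∑ i ∈ I, ∑ j ∈ J, (‖U' ω i j‖ ^ 2 - 1 / (n : ℝ))) ^ 2 ∂μ'
        + ε * ((I.card : ℝ) * J.card) ^ 2 / (n : ℝ) ^ 2 := by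
  have hn' : 0 < (n : ℝ) := by exact_mod_cast hn
  have h1 := sq_mul_integral_sq_block_eq hm hU hn I J
  have h2 := sq_mul_integral_sq_block_eq hm' hU' hn I J
  have h3 : (n : ℝ) ^ 2 * ∫ ω, (∑ i ∈ I, ∑ j ∈ J, (‖U ω i j‖ ^ 2 - 1 / (n : ℝ))) ^ 2 ∂μ
      ≤ (n : ℝ) ^ 2 * ∫ ω, (∑ i ∈ I, ∑ j ∈ J, (‖U' ω i j‖ ^ 2 - 1 / (n : ℝ))) ^ 2 ∂μ'
        + ε * ((I.card : ℝ) * J.card) ^ 2 := by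
    rw [h1, h2]
    have hε : ε * ((I.card : ℝ) * J.card) ^ 2 = ∑ p ∈ I ×ˢ J, ∑ q ∈ I ×ˢ J, ε := by
      simp only [Finset.sum_const, Finset.card_product, nsmul_eq_mul]
      push_cast; ring
    rw [hε, ← Finset.sum_add_distrib]
    refine Finset.sum_le_sum fun p _ => ?_
    rw [← Finset.sum_add_distrib]
    refine Finset.sum_le_sum fun q _ => ?_
    have := (abs_le.1 (h p q)).2
    linarith
  rw [← sub_le_iff_le_add', le_div_iff₀ (by positivity)]
  linarith

end Comparison

theorem proposition5p2 {𝕜 : Type*} [RCLike 𝕜]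
    {Ω : Type*} [MeasurableSpace Ω] (μ : Measure Ω) [IsProbabilityMeasure μ]
    {Ω' : Type*} [MeasurableSpace Ω'] (μ' : Measure Ω') [IsProbabilityMeasure μ']
    (y : ℝ) (hy : 0 < y) (m : ℕ → ℕ) (hm : ∀ n, 0 < m n)
    (hratio : Tendsto (fun n : ℕ => (n : ℝ) / (m n : ℝ)) atTop (𝓝 y))
    -- the data matrices: i.i.d. entries, whose law may depend on `n`
    (V : (n : ℕ) → Ω → Matrix (Fin n) (Fin (m n)) 𝕜)
    (hVmeas : ∀ n i j, Measurable fun ω => V n ω i j)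
    (hVindep : ∀ n, iIndepFun (fun (p : Fin n × Fin (m n)) ω => V n ω p.1 p.2) μ)
    (hVident : ∀ n i j i' j', IdentDistrib (fun ω => V n ω i j) (fun ω => V n ω i' j') μ μ)
    -- (i) absolute continuity with respect to Lebesgue measure
    (hVac : ∀ n i j, μ.map (fun ω => V n ω i j) ≪ (Measure.addHaar : Measure 𝕜))
    -- (ii) moments of all orders, bounded in `n`
    (hVmom : ∀ k : ℕ, ∃ C : ℝ≥0, ∀ n i j, ∫⁻ ω, ‖V n ω i j‖ₑ ^ k ∂μ ≤ C)
    -- the eigenmatrices of the sample covariance matrices, chosen in any measurable way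
    (U : (n : ℕ) → Ω → Matrix (Fin n) (Fin n) 𝕜)
    (hU : ∀ n, IsMeasurableEigenmatrix μ (fun ω => sampleCov (V n ω)) (U n))
    -- the Gaussian matrices and the eigenmatrices of the Laguerre matrices
    (M : (n : ℕ) → Ω' → Matrix (Fin n) (Fin (m n)) 𝕜)
    (hM : ∀ n, IsGaussianMatrix μ' (M n))
    (U' : (n : ℕ) → Ω' → Matrix (Fin n) (Fin n) 𝕜)
    (hU' : ∀ n, IsMeasurableEigenmatrix μ' (fun ω => sampleCov (M n ω)) (U' n))
    (hU'ker : ∀ n, KernelBasisUniform μ' (M n) (U' n)) :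
    -- (iii) with `l = 4`
    ((∀ n, MatchUpTo μ μ' 4 (V n) (M n)) → EigenvectorMatching μ μ' 4 m V U M U' →
      ∃ C : ℝ≥0, ∀ (n : ℕ) (i j : Fin n),
        eLpNorm (fun ω => (n : ℝ) * ‖U n ω i j‖ ^ 2 - 1) 4 μ ≤ C) ∧
    -- (iii) with `l = 8`
    ((∀ n, MatchUpTo μ μ' 8 (V n) (M n)) → EigenvectorMatching μ μ' 8 m V U M U' →
      ∃ C : ℝ≥0, ∀ (n : ℕ), 0 < n → ∀ s s' t t' : ℝ,
        0 ≤ s → s < s' → s' ≤ 1 → 0 ≤ t → t < t' → t' ≤ 1 →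
        1 / (n : ℝ) ≤ s' - s → 1 / (n : ℝ) ≤ t' - t →
        eLpNorm (fun ω => blockSum (U n ω) s s' t t') 2 μ ≤ C) := by
  have hu : ∀ n, ∀ᵐ ω ∂μ, U n ω ∈ Matrix.unitaryGroup (Fin n) 𝕜 := fun n =>
    (hU n).2.mono fun ω h => h.1
  have hu' : ∀ n, ∀ᵐ ω ∂μ', U' n ω ∈ Matrix.unitaryGroup (Fin n) 𝕜 := fun n =>
    (hU' n).2.mono fun ω h => h.1
  refine ⟨fun hmatch hE => ?_, fun hmatch hE => ?_⟩
  · obtain ⟨C, hC⟩ := hE hmatch 1 one_pos ((MvPolynomial.X 0 - 1) ^ 4)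
    refine ⟨((8 * (20 ^ 8 + 1) + C) ^ ((4 : ℕ) : ℝ)⁻¹ : ℝ).toNNReal, fun n i j => ?_⟩
    have h := hC n (fun _ => j) (fun _ => i) (fun _ => i)
    simp only [map_pow, map_sub, MvPolynomial.eval_X, map_one] at h
    simp only [mul_mul_star_sub_one, ← RCLike.ofReal_pow, integral_ofReal, ← RCLike.ofReal_sub, RCLike.norm_ofReal] at h
    -- At order 4 the exponent `2 - 4 / 2` is zero, so the error is the constant `C`.
    norm_num at h
    have h1 := (abs_le.1 h).2
    have h2 := laguerre_integral_sub_one_pow_four_le (hM n) (hm n) (hU' n) (hU'ker n) i j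
    have hL : MemLp (fun ω => (n : ℝ) * ‖U n ω i j‖ ^ 2 - 1) ((4 : ℕ) : ℝ≥0∞) μ :=
      memLp_of_continuous_of_unitary (hU n).1 (hu n)
        (f := fun A => (n : ℝ) * ‖A i j‖ ^ 2 - 1) (by fun_prop) _
    have h3 := eLpNorm_le_of_integral_pow_le (by decide) (by norm_num) hL
      (K := 8 * (20 ^ 8 + 1) + C) (by linarith)
    exact_mod_cast h3
  · obtain ⟨C, hC⟩ := hE hmatch 2 two_pos ((MvPolynomial.X 0 - 1) * (MvPolynomial.X 1 - 1))
    -- The 4 is the bound on `|A| |B| / (n² δ)`; the 16 is its square, from the number of pairs.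
    refine ⟨((4 * (30 * 20 ^ 4) + 16 * |C|) ^ ((2 : ℕ) : ℝ)⁻¹ : ℝ).toNNReal,
      fun n hn s s' t t' hs hss hs' ht htt ht' hns hnt => ?_⟩
    have hn' : 0 < (n : ℝ) := by exact_mod_cast hn
    have hcmp : ∀ p q : Fin n × Fin n,
        |∫ ω, ((n : ℝ) * ‖U n ω p.1 p.2‖ ^ 2 - 1) * ((n : ℝ) * ‖U n ω q.1 q.2‖ ^ 2 - 1) ∂μ
          - ∫ ω, ((n : ℝ) * ‖U' n ω p.1 p.2‖ ^ 2 - 1)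
            * ((n : ℝ) * ‖U' n ω q.1 q.2‖ ^ 2 - 1) ∂μ'| ≤ |C| / (n : ℝ) ^ 2 := by
      intro p q
      -- The hypothesis lists the column first and then two rows; equal rows give squared moduli.
      have h := hC n ![p.2, q.2] ![p.1, q.1] ![p.1, q.1]
      simp only [map_mul, map_sub, MvPolynomial.eval_X, map_one, Matrix.cons_val_zero,
        Matrix.cons_val_one] at h
      simp only [mul_mul_star_sub_one, ← RCLike.ofReal_mul, integral_ofReal, ← RCLike.ofReal_sub, RCLike.norm_ofReal] at h
      refine h.trans ?_
      have e : (n : ℝ) ^ (2 - ((8 : ℕ) : ℝ) / 2) = 1 / (n : ℝ) ^ 2 := by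
        rw [show (2 - ((8 : ℕ) : ℝ) / 2) = -((2 : ℕ) : ℝ) by norm_num, Real.rpow_neg hn'.le,
          Real.rpow_natCast, one_div]
      rw [e, ← div_eq_mul_one_div]
      gcongr
      exact le_abs_self C
    set A := blockIndices n s s' with hA
    set B := blockIndices n t t' with hB
    set δ := (s' - s) * (t' - t) with hδ
    have hδ0 : 0 < δ := mul_pos (by linarith) (by linarith)
    have hδ1 : δ ≤ 1 := mul_le_one₀ (by linarith) (by linarith) (by linarith)
    have hAc : (A.card : ℝ) ≤ 2 * (n * (s' - s)) := by
      have h1 := card_blockIndices_le (n := n) hss.le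
      rw [div_le_iff₀ hn'] at hns
      linarith
    have hBc : (B.card : ℝ) ≤ 2 * (n * (t' - t)) := by
      have h1 := card_blockIndices_le (n := n) htt.le
      rw [div_le_iff₀ hn'] at hnt
      linarith
    have hAB : (A.card : ℝ) * B.card ≤ 4 * (n : ℝ) ^ 2 * δ := by
      calc (A.card : ℝ) * B.card ≤ 2 * (n * (s' - s)) * (2 * (n * (t' - t))) :=
            mul_le_mul hAc hBc (by positivity) ((Nat.cast_nonneg _).trans hAc)
        _ = _ := by rw [hδ]; ring
    have h1 := integral_sq_block_le_add (hU n).1 (hu n) (hU' n).1 (hu' n) hcmp hn A B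
    have h2 := laguerre_integral_sq_block_le (hM n) (hm n) (hU' n) (hU'ker n) hn A B
    have hmain : ∫ ω, (∑ i ∈ A, ∑ j ∈ B, (‖U n ω i j‖ ^ 2 - 1 / (n : ℝ))) ^ 2 ∂μ
        ≤ (4 * (30 * 20 ^ 4) + 16 * |C|) * δ := by
      calc _ ≤ _ := h1
        _ ≤ 30 * 20 ^ 4 * (A.card * B.card) / (n : ℝ) ^ 2
            + |C| / (n : ℝ) ^ 2 * ((A.card : ℝ) * B.card) ^ 2 / (n : ℝ) ^ 2 := by gcongr
        _ ≤ 30 * 20 ^ 4 * (4 * (n : ℝ) ^ 2 * δ) / (n : ℝ) ^ 2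
            + |C| / (n : ℝ) ^ 2 * (4 * (n : ℝ) ^ 2 * δ) ^ 2 / (n : ℝ) ^ 2 := by gcongr
        _ = 4 * (30 * 20 ^ 4) * δ + 16 * |C| * (δ * δ) := by field_simp; ring
        -- Here `δ ≤ 1` reduces the quadratic error to a linear one, which the factor `1 / δ` in the
        -- squared block sum cancels.
        _ ≤ 4 * (30 * 20 ^ 4) * δ + 16 * |C| * (δ * 1) := by gcongr
        _ = _ := by ring
    have hL : MemLp (fun ω => blockSum (U n ω) s s' t t') ((2 : ℕ) : ℝ≥0∞) μ := by
      refine memLp_of_continuous_of_unitary (hU n).1 (hu n)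
        (f := fun A => blockSum A s s' t t') ?_ _
      unfold blockSum
      fun_prop
    have h3 := eLpNorm_le_of_integral_pow_le (by decide) (by norm_num) hL
      (K := 4 * (30 * 20 ^ 4) + 16 * |C|) (by
        simp only [blockSum, mul_pow, div_pow, one_pow]
        rw [integral_const_mul, Real.sq_sqrt hδ0.le, one_div_mul_eq_div, div_le_iff₀ hδ0]
        exact hmain)
    exact_mod_cast h3
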